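/- **Setup.** Let $c=6.6\,e$, $h(x)=\frac{2}{\ln\ln c}\,\ln\frac{c}{x}\,\bigl(\ln\ln\frac{c}{x}\bigr)^2$ for $x\in(0,1]$, and let $F(\beta)=\frac{1}{|\beta|\,h(|\beta|)}$, $0<|\beta|\le 1$, which is a probability density on $[-1,1]$. For $x_1,x_2,\dots\in[0,1]$, $t\ge1$ and $m\in[0,1]$ put $$W_t(m,\beta)=\prod_{i=1}^t(1+\beta(x_i-m)),\qquad \mathrm{Wealth}_t(m)=\int_{-1}^1 W_t(m,\beta)F(\beta)\,d\beta,$$ $$W^*_t(m)=\max_{\beta\in[-1,1]}W_t(m,\beta),\qquad \beta^*_t(m)\in\operatorname*{argmax}_{\beta\in[-1,1]}W_t(m,\beta),$$ $q_t(m)=\min_{i\le t}(x_i-m)\,\mathrm{sign}(\beta^*_t(m))$, $V_t(m)=\sum_{i=1}^t(x_i-m)^2$, $d_t(m)=1+\min(q_t(m)|\beta^*_t(m)|,0)$; $\tilde\Delta_t(m)=d_t(m)/\sqrt{V_t(m)}$ if $|\beta^*_t(m)|<1$ and $\tilde\Delta_t(m)=0$ if $|\beta^*_t(m)|=1$; $\Delta_t(m)=|\beta^*_t(m)|-\max(|\beta^*_t(m)|-\tilde\Delta_t(m),0)$;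 and $$R_t(m)=\left[\max\left(\frac{1-1/W^*_t(m)}{\ln W^*_t(m)}\,|\beta^*_t(m)|,\ \exp\Bigl(-\frac{\Delta_t(m)^2V_t(m)}{2d_t(m)^2}\Bigr)\Delta_t(m)\right)F(\beta^*_t(m))\right]^{-1},$$ where $\frac{1-1/w}{\ln w}$ is read as $1$ at $w=1$, and $R_t(m)=\infty$ if $\beta^*_t(m)=0$. Let $\hat\mu_t=\frac1t\sum_{i=1}^tx_i$. For $\delta\in(0,1)$ let $m_{\ell,t}$ be the smallest $m\in[0,\hat\mu_t]$ and $m_{u,t}$ the largest $m\in[\hat\mu_t,1]$ with $W^*_t(m)\le R_t(m)/\delta$ (infimum and supremum), and let $\ell_0=0$, $u_0=1$, $\ell_t=\max(m_{\ell,t},\ell_{t-1})$, $u_t=\min(m_{u,t},u_{t-1})$. Finally let $V_t=\sum_{i=1}^t(x_i-\hat\mu_t)^2$ and $$U_t=-\tfrac12W_{-1}\left(-\frac{2}{\bigl(\frac{20}{3\delta}\,h\bigl(\frac{1}{2+\sqrt{V_t/2}}\bigr)\bigr)^2}\right),$$ where $W_{-1}$ is the negative branch of the Lambert function ($W_{-1}(y)$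 is the $w\le-1$ with $we^w=y$, for $y\in[-1/e,0)$). **Theorem.** 1. (Regret) For all $x_1,x_2,\dots\in[0,1]$, $t\ge1$ and $m\in[0,1]$: $\ \ln W^*_t(m)-\ln\mathrm{Wealth}_t(m)\le\ln R_t(m)$. 2. (Confidence sequence) Let $\delta\in(0,1)$ and let $X_1,X_2,\dots$ be random variables with $0\le X_i\le1$ almost surely and $\mathbb E[X_i\mid X_1,\dots,X_{i-1}]=\mu$ for all $i$. Then, for $\ell_t,u_t$ computed from $X_1,X_2,\dots$, with probability at least $1-\delta$ we have $\mu\in[\ell_t,u_t]$ for all $t\ge1$. 3. (Width) For all $\delta\in(0,1)$, $x_1,x_2,\dots\in[0,1]$ and $t\ge1$ with $t>2U_t$, both $u_t-\hat\mu_t$ and $\hat\mu_t-\ell_t$ are at most $$\frac1t\sqrt{\max\left(\frac{U_t}{1-2U_t/t},1\right)2V_t}+\frac{\frac43U_t}{t-2U_t}+\frac{24}{t}\ln\frac{7}{6\delta}.$$ 4. $U_t=O\bigl(\ln\frac{\ln^3t}{\delta}\bigr)$: there are constants $K$ and $t_0$, independent of $\delta\in(0,1)$ and of $x_1,x_2,\dots\in[0,1]$,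 such that $|U_t|\le K\ln\frac{\ln^3t}{\delta}$ for all $t\ge t_0$. 5. (Law of the iterated logarithm) For every $\delta\in(0,1)$ there is a sequence $\varepsilon_t=o\bigl(\sqrt{\ln\ln t/t}\bigr)$, $t\to\infty$, such that for all $x_1,x_2,\dots\in[0,1]$ and $t\ge1$ both $u_t-\hat\mu_t$ and $\hat\mu_t-\ell_t$ are at most $\frac{1}{t}\sqrt{2V_t\ln\frac{\ln V_t}{\delta}}+\varepsilon_t$, where the first term is read as $0$ if $V_t\le e$. -/

import Mathlib

open MeasureTheory Filter Asymptotics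
open scoped ENNReal

noncomputable section

namespace PreciseR70

/-! Samples are sequences `x : ℕ → ℝ`; the first `t` samples are `x 0, …, x (t - 1)`. -/

/-- The constant `c = 6.6 e`. -/
def c : ℝ := 6.6 * Real.exp 1

/-- `h(x) = (2 / ln ln c) · ln (c / x) · (ln ln (c / x))²`, for `x ∈ (0, 1]`. -/
def h (x : ℝ) : ℝ :=
  2 / Real.log (Real.log c) * Real.log (c / x) * Real.log (Real.log (c / x)) ^ 2

/-- The prior density `F(β) = 1 / (|β| h(|β|))` on `[-1, 1]` (the value at the single point
`β = 0`, where the density is infinite, plays no role). -/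
def F (β : ℝ) : ℝ := 1 / (|β| * h |β|)

/-- Wealth of the constant betting fraction `β` after `t` rounds, on the coins `x i - m`. -/
def wealth (x : ℕ → ℝ) (t : ℕ) (m β : ℝ) : ℝ :=
  ∏ i ∈ Finset.range t, (1 + β * (x i - m))

/-- Wealth of the mixture strategy with prior density `F`. -/
def mixtureWealth (x : ℕ → ℝ) (t : ℕ) (m : ℝ) : ℝ :=
  ∫ β in (-1 : ℝ)..1, wealth x t m β * F β

theorem exists_best (x : ℕ → ℝ) (t : ℕ) (m : ℝ) :
    ∃ β ∈ Set.Icc (-1 : ℝ) 1, IsMaxOn (wealth x t m) (Set.Icc (-1) 1) β :=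
  isCompact_Icc.exists_isMaxOn ⟨0, by norm_num⟩
    (by unfold wealth; fun_prop)

/-- `β*_t(m)`, a maximizer over `[-1, 1]` of the wealth of constant fractions. It is unique when
`m ∈ [0, 1]` and the samples lie in `[0, 1]`, unless `x i = m` for all `i < t` (then the wealth
is constantly `1`, and the choice is arbitrary). -/
def betaStar (x : ℕ → ℝ) (t : ℕ) (m : ℝ) : ℝ := (exists_best x t m).choose

/-- `Wealth*_t(m)`, the maximal wealth over constant betting fractions in `[-1, 1]`. -/
def wealthStar (x : ℕ → ℝ) (t : ℕ) (m : ℝ) : ℝ := wealth x t m (betaStar x t m)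

/-- Regret of the mixture strategy against the best constant betting fraction in `[-1, 1]`. -/
def regret (x : ℕ → ℝ) (t : ℕ) (m : ℝ) : ℝ :=
  Real.log (wealthStar x t m) - Real.log (mixtureWealth x t m)

/-- `q_t(m) = min_i (x_i - m) sign(β*_t(m))`. -/
def q (x : ℕ → ℝ) (t : ℕ) (m : ℝ) : ℝ :=
  ⨅ i : Fin t, (x i - m) * Real.sign (betaStar x t m)

/-- `V_t(m) = ∑ (x_i - m)²`. -/
def V (x : ℕ → ℝ) (t : ℕ) (m : ℝ) : ℝ := ∑ i ∈ Finset.range t, (x i - m) ^ 2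

/-- `1 + min (q_t(m) |β*_t(m)|, 0)`. -/
def d (x : ℕ → ℝ) (t : ℕ) (m : ℝ) : ℝ := 1 + min (q x t m * |betaStar x t m|) 0

def deltaTilde (x : ℕ → ℝ) (t : ℕ) (m : ℝ) : ℝ :=
  if |betaStar x t m| < 1 then d x t m / √(V x t m) else 0

def Delta (x : ℕ → ℝ) (t : ℕ) (m : ℝ) : ℝ :=
  |betaStar x t m| - max (|betaStar x t m| - deltaTilde x t m) 0

/-- `(1 - 1/w) / ln w`, extended by continuity to `1` at `w = 1`. -/
def logRatio (w : ℝ) : ℝ := if w = 1 then 1 else (1 - 1 / w) / Real.log w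

/-- The regret bound `R_t(m)` on the multiplicative scale,
`1 / (max ((1 - 1/W*) / ln W* · |β*|, exp (-Δ² V / (2 d²)) · Δ) · F(β*))`,
with values in `[0, ∞]`; it is `∞` when `β*_t(m) = 0`. -/
def R (x : ℕ → ℝ) (t : ℕ) (m : ℝ) : ℝ≥0∞ :=
  1 / ENNReal.ofReal
    (max (logRatio (wealthStar x t m) * |betaStar x t m|)
        (Real.exp (-(Delta x t m ^ 2 * V x t m) / (2 * d x t m ^ 2)) * Delta x t m)
      * F (betaStar x t m))

/-- Empirical mean of the first `t` samples. -/
def muHat (x : ℕ → ℝ) (t : ℕ) : ℝ := (∑ i ∈ Finset.range t, x i) / t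

/-- The values `m` that are not rejected at time `t`: `Wealth*_t(m) ≤ R_t(m) / δ`. -/
def accepted (δ : ℝ) (x : ℕ → ℝ) (t : ℕ) : Set ℝ :=
  {m | ENNReal.ofReal (wealthStar x t m) ≤ R x t m / ENNReal.ofReal δ}

/-- The smallest accepted `m` in `[0, muHat]` (`muHat` itself is always accepted). -/
def mLow (δ : ℝ) (x : ℕ → ℝ) (t : ℕ) : ℝ :=
  sInf (Set.Icc 0 (muHat x t) ∩ accepted δ x t)

/-- The largest accepted `m` in `[muHat, 1]`. -/
def mUp (δ : ℝ) (x : ℕ → ℝ) (t : ℕ) : ℝ :=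
  sSup (Set.Icc (muHat x t) 1 ∩ accepted δ x t)

/-- Lower end of the confidence set, `ℓ_t = max (m_ℓ, ℓ_{t-1})`, `ℓ_0 = 0`. -/
def lower (δ : ℝ) (x : ℕ → ℝ) : ℕ → ℝ
  | 0 => 0
  | t + 1 => max (mLow δ x (t + 1)) (lower δ x t)

/-- Upper end of the confidence set, `u_t = min (m_u, u_{t-1})`, `u_0 = 1`. -/
def upper (δ : ℝ) (x : ℕ → ℝ) : ℕ → ℝ
  | 0 => 1
  | t + 1 => min (mUp δ x (t + 1)) (upper δ x t)

/-- The negative branch `W₋₁` of the Lambert function: for `y ∈ [-1/e, 0)`, the set below is the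
singleton of the unique `w ≤ -1` with `w eʷ = y`. -/
def lambertWm1 (y : ℝ) : ℝ := sInf {w : ℝ | w ≤ -1 ∧ w * Real.exp w = y}

/-- Empirical sum of squares `V_t = ∑ (x_i - muHat_t)²`. -/
def VHat (x : ℕ → ℝ) (t : ℕ) : ℝ := V x t (muHat x t)

/-- `U_t = -½ W₋₁(-2 / ((20 / (3δ)) h(1 / (2 + √(V_t / 2))))²)`. -/
def U (δ : ℝ) (x : ℕ → ℝ) (t : ℕ) : ℝ :=
  -(1 / 2) * lambertWm1 (-2 / (20 / (3 * δ) * h (1 / (2 + √(VHat x t / 2)))) ^ 2)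

/-- The explicit half-width bound; it is meaningful for `t > 2 U_t`. -/
def widthBound (δ : ℝ) (x : ℕ → ℝ) (t : ℕ) : ℝ :=
  1 / t * √(max (U δ x t / (1 - 2 * U δ x t / t)) 1 * (2 * VHat x t))
    + (4 / 3 * U δ x t) / (t - 2 * U δ x t)
    + 24 / t * Real.log (7 / (6 * δ))

/-- The leading term `√(2 V_t ln (ln V_t / δ)) / t`, read as `0` when `V_t ≤ e`. -/
def lilWidth (δ : ℝ) (x : ℕ → ℝ) (t : ℕ) : ℝ :=
  if Real.exp 1 < VHat x t then
    √(2 * VHat x t * Real.log (Real.log (VHat x t) / δ)) / t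
  else 0

end PreciseR70

end

noncomputable section

namespace PreciseR70

/-! ### The prior density -/

/-! Regret. The density `F` decreases in `|β|`, so the mixture is at least `F(β*)` times the
integral of the wealth over any interval with endpoint `β*` that does not cross `0`. Two lower
bounds on the wealth there give the two terms of the maximum in `R`. Concavity of the logarithm
makes the wealth along the segment from `0` to `β*` at least a power of `W*`
(`mul_logRatio_le_integral`). At an interior maximizer the first-order condition leaves only a
quadratic loss, so the wealth near `β*` dominates a Gaussian bump (`prod_exp_le_prod`). Both steps
combine into `wealthStar_mul_invR_le`: `W* / R` is at most the mixture wealth.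

Coverage. At the true mean the mixture wealth is a nonnegative martingale starting at `1`, because
`F` integrates to `1`. By Ville's inequality it ever exceeds `1/δ` with probability at most `δ`. As
long as it does not, `W* ≤ R/δ` by the regret bound and the mean is never rejected.

Width. Put `S = t |muHat - m|`. A well-chosen fraction gives `ln W* ≥ S² / (2 (V(m) + 2S/3))`
(`log_wealthStar_ge`). Conversely, acceptance of `m` bounds `L = ln W*` from above: apart from one
case, `e^L ≤ K √L` with `K` the quantity `Karg`, and `U` is the largest solution of `e^L = K √L`, so
`L ≤ U`. Small bets use the Gaussian term of `R` and large bets use the power term; the exceptional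
case is a large bet with large `L`, where `S` is at most a multiple of `ln (7/(6δ))`. Comparing the
two bounds on `L` and solving a quadratic inequality in `S` gives the half-width.

Asymptotics. From `U = ln K + (1/2) ln U` and the growth of `h`, `U` equals at most `ln (ln V / δ)`
plus `O(ln ln ln t)`, and every other term of the width is `o(√(ln ln t / t))`. -/

theorem exp_le_of_tenth {x y z : ℝ} (hx0 : 0 ≤ x) (hx1 : x ≤ 10)
    (h1 : 1 + x / 10 + (x / 10) ^ 2 / 2 + (x / 10) ^ 3 / 6 + (x / 10) ^ 4 / 24
      + (x / 10) ^ 5 * 6 / 600 ≤ y) (hy : y ^ 10 ≤ z) : Real.exp x ≤ z := by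
  -- The Taylor bound needs an argument in `[0, 1]`; it is applied at `x / 10`, and the tenth power
  -- is taken afterwards.
  have hb := Real.exp_bound' (x := x / 10) (by positivity) (by linarith) (n := 5) (by norm_num)
  simp only [Finset.sum_range_succ, Finset.sum_range_zero, Nat.factorial] at hb
  norm_num at hb
  have h2 : Real.exp (x / 10) ≤ y := by
    refine hb.trans (le_trans (le_of_eq ?_) h1)
    ring
  calc Real.exp x = Real.exp (x / 10) ^ 10 := by
        rw [← Real.exp_nat_mul]; congr 1; push_cast; ring
    _ ≤ y ^ 10 := by gcongr
    _ ≤ z := hy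

theorem c_pos : 0 < c := by unfold c; positivity

theorem le_log_c : 2.887 ≤ Real.log c := by
  have h1 : (1.887 : ℝ) ≤ Real.log 6.6 := by
    rw [Real.le_log_iff_exp_le (by norm_num)]
    exact exp_le_of_tenth (y := 1.207684) (by norm_num) (by norm_num) (by norm_num) (by norm_num)
  unfold c
  rw [Real.log_mul (by norm_num) (Real.exp_ne_zero _), Real.log_exp]
  linarith

theorem le_log_of_le {u : ℝ} (hu : 2.887 ≤ u) : 1.06 ≤ Real.log u := by
  rw [Real.le_log_iff_exp_le (by linarith)]
  exact (exp_le_of_tenth (y := 1.111823) (z := 2.887) (by norm_num) (by norm_num) (by norm_num)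
    (by norm_num)).trans hu

theorem le_log_log_c : 1.06 ≤ Real.log (Real.log c) := le_log_of_le le_log_c

theorem log_c_le_log_div {x : ℝ} (hx0 : 0 < x) (hx1 : x ≤ 1) :
    Real.log c ≤ Real.log (c / x) :=
  Real.log_le_log c_pos (by rw [le_div_iff₀ hx0]; nlinarith [c_pos])

theorem le_log_div {x : ℝ} (hx0 : 0 < x) (hx1 : x ≤ 1) : 2.887 ≤ Real.log (c / x) :=
  le_log_c.trans (log_c_le_log_div hx0 hx1)

theorem le_log_log_div {x : ℝ} (hx0 : 0 < x) (hx1 : x ≤ 1) :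
    1.06 ≤ Real.log (Real.log (c / x)) :=
  le_log_of_le (le_log_div hx0 hx1)

theorem h_pos {x : ℝ} (hx0 : 0 < x) (hx1 : x ≤ 1) : 0 < h x := by
  have h1 := le_log_div hx0 hx1
  have h2 := le_log_log_div hx0 hx1
  have h3 := le_log_log_c
  unfold h
  have : 0 < Real.log (Real.log c) := by linarith
  have : 0 < Real.log (c / x) := by linarith
  have : 0 < Real.log (Real.log (c / x)) := by linarith
  positivity

theorem h_anti {x y : ℝ} (hx0 : 0 < x) (hxy : x ≤ y) (hy1 : y ≤ 1) : h y ≤ h x := by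
  have hy0 := hx0.trans_le hxy
  have h1 := le_log_div hy0 hy1
  have h2 := le_log_log_div hy0 hy1
  have h3 := le_log_log_c
  have h4 : Real.log (c / y) ≤ Real.log (c / x) :=
    Real.log_le_log (div_pos c_pos hy0) (div_le_div_of_nonneg_left c_pos.le hx0 hxy)
  have h5 : Real.log (Real.log (c / y)) ≤ Real.log (Real.log (c / x)) :=
    Real.log_le_log (by linarith) h4
  unfold h
  have : 0 < Real.log (Real.log c) := by linarith
  have : 0 < Real.log (c / x) := by linarith
  gcongr ?_ * ?_ * ?_ ^ 2

theorem four_le_h {x : ℝ} (hx0 : 0 < x) (hx1 : x ≤ 1) : 4 ≤ h x := by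
  refine le_trans ?_ (h_anti hx0 hx1 le_rfl)
  have h3 := le_log_log_c
  have h4 := le_log_c
  unfold h
  rw [div_one]
  have : 2 / Real.log (Real.log c) * Real.log c * Real.log (Real.log c) ^ 2
      = 2 * Real.log c * Real.log (Real.log c) := by
    field_simp [show Real.log (Real.log c) ≠ 0 by linarith]
  rw [this]
  nlinarith

theorem hasDerivAt_log_div {x : ℝ} (hx0 : 0 < x) :
    HasDerivAt (fun x => Real.log (c / x)) (-(1 / x)) x := by
  have h1 : HasDerivAt (fun x => Real.log c - Real.log x) (-(1 / x)) x := by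
    simpa using (Real.hasDerivAt_log hx0.ne').const_sub (Real.log c)
  refine h1.congr_of_eventuallyEq ?_
  filter_upwards [lt_mem_nhds hx0] with y hy
  rw [Real.log_div c_pos.ne' hy.ne']

theorem hasDerivAt_log_log_div {x : ℝ} (hx0 : 0 < x) (hx1 : x ≤ 1) :
    HasDerivAt (fun x => Real.log (Real.log (c / x))) (-(1 / x) / Real.log (c / x)) x :=
  (hasDerivAt_log_div hx0).log (by linarith [le_log_div hx0 hx1])

theorem hasDerivAt_mul_h {x : ℝ} (hx0 : 0 < x) (hx1 : x ≤ 1) :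
    HasDerivAt (fun x => x * h x)
      (2 / Real.log (Real.log c) * (Real.log (Real.log (c / x)) *
        ((Real.log (c / x) - 1) * Real.log (Real.log (c / x)) - 2))) x := by
  have h1 := le_log_div hx0 hx1
  have := (hasDerivAt_id x).mul ((((hasDerivAt_log_div hx0).const_mul
    (2 / Real.log (Real.log c))).mul ((hasDerivAt_log_log_div hx0 hx1).pow 2)))
  refine this.congr_deriv ?_
  have : Real.log (c / x) ≠ 0 := by linarith
  have h3 := le_log_log_c
  have : Real.log (Real.log c) ≠ 0 := by linarith
  simp only [id, Pi.mul_apply, Pi.pow_apply]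
  field_simp
  ring

/-- This is what the constant 6.6 in `c` is for: the sign of the derivative is that of `(ln (c/x) -
1) ln ln (c/x) - 2`, which is smallest at `x = 1`, and the numerical bounds there give `1.887 * 1.06
> 2` with almost no slack. It makes `F` decreasing in `|β|`. -/
theorem mul_h_mono {x y : ℝ} (hx0 : 0 < x) (hxy : x ≤ y) (hy1 : y ≤ 1) :
    x * h x ≤ y * h y := by
  have hd : ∀ z ∈ Set.Icc x 1, HasDerivAt (fun x => x * h x)
      (2 / Real.log (Real.log c) * (Real.log (Real.log (c / z)) *
        ((Real.log (c / z) - 1) * Real.log (Real.log (c / z)) - 2))) z :=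
    fun z hz => hasDerivAt_mul_h (hx0.trans_le hz.1) hz.2
  have := monotoneOn_of_deriv_nonneg (convex_Icc x 1)
    (fun z hz => (hd z hz).continuousAt.continuousWithinAt)
    (fun z hz => (hd z (interior_subset hz)).differentiableAt.differentiableWithinAt)
    (fun z hz => by
      have hz' := interior_subset hz
      rw [(hd z hz').deriv]
      have h1 := le_log_div (hx0.trans_le hz'.1) hz'.2
      have h2 := le_log_log_div (hx0.trans_le hz'.1) hz'.2
      have h3 := le_log_log_c
      have : 0 < Real.log (Real.log c) := by linarith
      have : 0 ≤ (Real.log (c / z) - 1) * Real.log (Real.log (c / z)) - 2 := by nlinarith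
      have : 0 ≤ Real.log (Real.log (c / z)) := by linarith
      positivity)
  exact this ⟨le_rfl, hxy.trans hy1⟩ ⟨hxy, hy1⟩ hxy

theorem F_neg (β : ℝ) : F (-β) = F β := by simp [F]

theorem F_abs (β : ℝ) : F |β| = F β := by simp [F]

theorem F_zero : F 0 = 0 := by simp [F]

theorem F_nonneg {β : ℝ} (hβ : |β| ≤ 1) : 0 ≤ F β := by
  rcases eq_or_ne β 0 with rfl | h0
  · simp [F]
  · have := h_pos (abs_pos.2 h0) hβ
    unfold F; positivity

theorem F_pos {β : ℝ} (h0 : β ≠ 0) (hβ : |β| ≤ 1) : 0 < F β := by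
  have := h_pos (abs_pos.2 h0) hβ
  have := abs_pos.2 h0
  unfold F; positivity

theorem F_anti {x y : ℝ} (hx0 : 0 < x) (hxy : x ≤ y) (hy1 : y ≤ 1) : F y ≤ F x := by
  have hy0 := hx0.trans_le hxy
  unfold F
  rw [abs_of_pos hx0, abs_of_pos hy0]
  exact one_div_le_one_div_of_le (mul_pos hx0 (h_pos hx0 (hxy.trans hy1))) (mul_h_mono hx0 hxy hy1)

/-- An antiderivative of the prior density on `[0, 1]`. -/
def cdf (x : ℝ) : ℝ := Real.log (Real.log c) / 2 * (Real.log (Real.log (c / x)))⁻¹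

theorem hasDerivAt_cdf {x : ℝ} (hx0 : 0 < x) (hx1 : x ≤ 1) : HasDerivAt cdf (F x) x := by
  have h1 := le_log_div hx0 hx1
  have h2 := le_log_log_div hx0 hx1
  have h3 := le_log_log_c
  have := ((hasDerivAt_log_log_div hx0 hx1).inv (by linarith)).const_mul
    (Real.log (Real.log c) / 2)
  refine this.congr_deriv ?_
  have : Real.log (c / x) ≠ 0 := by linarith
  have : Real.log (Real.log (c / x)) ≠ 0 := by linarith
  have : Real.log (Real.log c) ≠ 0 := by linarith
  unfold F h
  rw [abs_of_pos hx0]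
  field_simp

theorem continuousOn_cdf : ContinuousOn cdf (Set.Icc 0 1) := by
  intro x hx
  rcases hx.1.eq_or_lt with rfl | h0
  · rw [← continuousWithinAt_sdiff_self]
    have h1 : Tendsto (fun x => c / x) (nhdsWithin 0 (Set.Icc 0 1 \ {0})) atTop := by
      simp only [div_eq_mul_inv]
      refine Tendsto.const_mul_atTop c_pos (tendsto_inv_nhdsGT_zero.mono_left ?_)
      exact nhdsWithin_mono _ fun y hy => lt_of_le_of_ne hy.1.1 (Ne.symm hy.2)
    have h2 := (((Real.tendsto_log_atTop.comp
      (Real.tendsto_log_atTop.comp h1)).inv_tendsto_atTop).const_mul (Real.log (Real.log c) / 2))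
    -- The conventions for division by zero and for the logarithm at `0` happen to give `cdf 0` the
    -- value of its right limit, since `ln ln (c/x)` tends to infinity.
    have h3 : cdf 0 = 0 := by simp [cdf]
    unfold ContinuousWithinAt
    rw [h3]
    unfold cdf
    simpa only [mul_zero, Function.comp_def, Pi.inv_apply] using h2
  · exact (hasDerivAt_cdf h0 hx.2).continuousAt.continuousWithinAt

/-- `F` is unbounded near `0`; integrability holds because it is the nonnegative derivative of a
function continuous up to the endpoint. -/
theorem intervalIntegrable_F_zero_one : IntervalIntegrable F volume 0 1 := by
  refine intervalIntegral.intervalIntegrable_deriv_of_nonneg (g := cdf) ?_ ?_ ?_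
  · rw [Set.uIcc_of_le zero_le_one]; exact continuousOn_cdf
  · intro x hx
    simp only [zero_le_one, inf_of_le_left, sup_of_le_right] at hx
    exact hasDerivAt_cdf hx.1 hx.2.le
  · intro x hx
    simp only [zero_le_one, inf_of_le_left, sup_of_le_right] at hx
    exact F_nonneg (by rw [abs_of_pos hx.1]; exact hx.2.le)

theorem intervalIntegrable_F : IntervalIntegrable F volume (-1) 1 := by
  refine IntervalIntegrable.trans (b := 0) ?_ intervalIntegrable_F_zero_one
  have := (intervalIntegrable_F_zero_one.comp_sub_left 0).symm
  simpa [F_neg] using this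

theorem integral_F_zero_one : ∫ β in (0 : ℝ)..1, F β = 1 / 2 := by
  rw [intervalIntegral.integral_eq_sub_of_hasDerivAt_of_le zero_le_one continuousOn_cdf
    (fun x hx => hasDerivAt_cdf hx.1 hx.2.le) intervalIntegrable_F_zero_one]
  have h3 := le_log_log_c
  have : Real.log (Real.log c) ≠ 0 := by linarith
  simp [cdf]
  field_simp

theorem integral_F : ∫ β in (-1 : ℝ)..1, F β = 1 := by
  have h0 : IntervalIntegrable F volume (-1) 0 :=
    intervalIntegrable_F.mono_set (by
      rw [Set.uIcc_of_le (by norm_num), Set.uIcc_of_le (by norm_num)]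
      exact Set.Icc_subset_Icc_right zero_le_one)
  rw [← intervalIntegral.integral_add_adjacent_intervals h0 intervalIntegrable_F_zero_one]
  have := intervalIntegral.integral_comp_neg (a := 0) (b := 1) F
  simp only [F_neg, neg_zero] at this
  rw [← this, integral_F_zero_one]
  norm_num

/-! ### Wealth of a constant betting fraction -/

section Betting

variable {a : ℕ → ℝ} {t : ℕ}

theorem one_add_mul_nonneg {u y : ℝ} (hu : |u| ≤ 1) (hy : |y| ≤ 1) : 0 ≤ 1 + u * y := by
  have : |u * y| ≤ 1 := by
    rw [abs_mul]; exact mul_le_one₀ hu (abs_nonneg _) hy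
  linarith [(abs_le.1 this).1]

theorem prod_nonneg_of_abs_le (ha : ∀ i < t, |a i| ≤ 1) {u : ℝ} (hu : |u| ≤ 1) :
    0 ≤ ∏ i ∈ Finset.range t, (1 + u * a i) :=
  Finset.prod_nonneg fun i hi => one_add_mul_nonneg hu (ha i (Finset.mem_range.1 hi))

theorem continuous_prod (a : ℕ → ℝ) (t : ℕ) :
    Continuous fun u : ℝ => ∏ i ∈ Finset.range t, (1 + u * a i) := by fun_prop

/-- Log-concavity of the wealth between the fractions `0` and `b`; factor by factor it is
Bernoulli's inequality for an exponent in `[0, 1]`. -/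
theorem prod_rpow_le_prod (ha : ∀ i < t, |a i| ≤ 1) {b r : ℝ} (hb : |b| ≤ 1)
    (hr0 : 0 ≤ r) (hr1 : r ≤ 1) :
    (∏ i ∈ Finset.range t, (1 + b * a i)) ^ r ≤ ∏ i ∈ Finset.range t, (1 + (r * b) * a i) := by
  have h0 : ∀ i ∈ Finset.range t, 0 ≤ 1 + b * a i :=
    fun i hi => one_add_mul_nonneg hb (ha i (Finset.mem_range.1 hi))
  rw [← Real.finsetProd_rpow _ _ h0]
  refine Finset.prod_le_prod (fun i hi => Real.rpow_nonneg (h0 i hi) _) fun i hi => ?_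
  have := rpow_one_add_le_one_add_mul_self (s := b * a i) (by linarith [h0 i hi]) hr0 hr1
  rwa [mul_assoc]

theorem integral_rpow_div {w b : ℝ} (hw : 1 ≤ w) (hb : 0 < b) :
    ∫ u in (0 : ℝ)..b, w ^ (u / b) = w * (logRatio w * b) := by
  rcases hw.eq_or_lt with rfl | hw
  · simp [logRatio]
  have hl : 0 < Real.log w := Real.log_pos hw
  have hd : ∀ u ∈ Set.uIcc 0 b,
      HasDerivAt (fun u => w ^ (u / b) * (b / Real.log w)) (w ^ (u / b)) u := by
    intro u _
    have := (((hasDerivAt_id u).div_const b).const_rpow (a := w) (by linarith)).mul_const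
      (b / Real.log w)
    refine this.congr_deriv ?_
    simp only [id]
    field_simp
  rw [intervalIntegral.integral_eq_sub_of_hasDerivAt hd]
  · have hw' : w ≠ 0 := by linarith
    simp only [div_self hb.ne', zero_div, Real.rpow_one, Real.rpow_zero, logRatio, hw.ne',
      if_false]
    field_simp
  · exact (Continuous.rpow continuous_const (by fun_prop)
      (fun _ => Or.inl (by linarith))).intervalIntegrable _ _

/-- Integrating `w ^ (u/b)`, the lower bound from log-concavity, over `[0, b]` gives exactly `w *
logRatio w * b`; this is the origin of `logRatio` in `R`. -/
theorem mul_logRatio_le_integral (ha : ∀ i < t, |a i| ≤ 1) {b : ℝ} (hb0 : 0 < b) (hb1 : b ≤ 1)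
    (hw : 1 ≤ ∏ i ∈ Finset.range t, (1 + b * a i)) :
    (∏ i ∈ Finset.range t, (1 + b * a i)) * (logRatio (∏ i ∈ Finset.range t, (1 + b * a i)) * b)
      ≤ ∫ u in (0 : ℝ)..b, ∏ i ∈ Finset.range t, (1 + u * a i) := by
  rw [← integral_rpow_div hw hb0]
  refine intervalIntegral.integral_mono_on hb0.le
    ((Continuous.rpow continuous_const (by fun_prop)
      (fun _ => Or.inl (by linarith))).intervalIntegrable _ _)
    ((continuous_prod a t).intervalIntegrable _ _) fun u hu => ?_
  have := prod_rpow_le_prod ha (b := b) (r := u / b) (by rw [abs_of_pos hb0]; exact hb1)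
    (div_nonneg hu.1 hb0.le) (div_le_one_of_le₀ hu.2 hb0.le)
  rwa [div_mul_cancel₀ u hb0.ne'] at this

/-! ### Logarithm inequalities and the Gaussian lower bound at a stationary point. -/

theorem log_le_half_sub_inv {s : ℝ} (hs : 1 ≤ s) : Real.log s ≤ (s - s⁻¹) / 2 := by
  have hd : ∀ z ∈ Set.Ici (1 : ℝ), HasDerivAt (fun z => (z - z⁻¹) / 2 - Real.log z)
      ((1 - (-(z ^ 2)⁻¹)) / 2 - z⁻¹) z := fun z hz => by
    have hz0 : z ≠ 0 := by have := Set.mem_Ici.1 hz; linarith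
    exact (((hasDerivAt_id z).sub (hasDerivAt_inv hz0)).div_const 2).sub (Real.hasDerivAt_log hz0)
  have := monotoneOn_of_deriv_nonneg (convex_Ici 1)
    (fun z hz => (hd z hz).continuousAt.continuousWithinAt)
    (fun z hz => (hd z (interior_subset hz)).differentiableAt.differentiableWithinAt)
    (fun z hz => by
      rw [(hd z (interior_subset hz)).deriv]
      have : (1 - (-(z ^ 2)⁻¹)) / 2 - z⁻¹ = (1 - z⁻¹) ^ 2 / 2 := by rw [← inv_pow]; ring
      rw [this]; positivity)
  have := this (Set.mem_Ici.2 le_rfl) (Set.mem_Ici.2 hs) hs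
  simp at this
  linarith

theorem half_sub_inv_le_log {s : ℝ} (hs0 : 0 < s) (hs : s ≤ 1) : (s - s⁻¹) / 2 ≤ Real.log s := by
  have := log_le_half_sub_inv (s := s⁻¹) ((one_le_inv₀ hs0).2 hs)
  rw [Real.log_inv, inv_inv] at this
  linarith

theorem sub_half_sq_le_log {s : ℝ} (hs : 1 ≤ s) : s - 1 - (s - 1) ^ 2 / 2 ≤ Real.log s := by
  have hd : ∀ z ∈ Set.Ici (1 : ℝ), HasDerivAt (fun z => Real.log z - (z - 1 - (z - 1) ^ 2 / 2))
      (z⁻¹ - (1 - 2 * (z - 1) / 2)) z := fun z hz => by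
    have hz0 : z ≠ 0 := by have := Set.mem_Ici.1 hz; linarith
    have h1 := (hasDerivAt_id z).sub_const 1
    have := (Real.hasDerivAt_log hz0).sub (h1.sub ((h1.pow 2).div_const 2))
    refine this.congr_deriv ?_
    simp
  have := monotoneOn_of_deriv_nonneg (convex_Ici 1)
    (fun z hz => (hd z hz).continuousAt.continuousWithinAt)
    (fun z hz => (hd z (interior_subset hz)).differentiableAt.differentiableWithinAt)
    (fun z hz => by
      rw [(hd z (interior_subset hz)).deriv]
      have hz1 : 1 ≤ z := interior_subset hz
      have : z⁻¹ - (1 - 2 * (z - 1) / 2) = (1 - z) ^ 2 / z := by field_simp; ring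
      rw [this]; positivity)
  have := this (Set.mem_Ici.2 le_rfl) (Set.mem_Ici.2 hs) hs
  simp at this
  linarith

/-- Quadratic lower bound for the logarithm around `v`, above `d`. -/
theorem log_quadratic_lower {u v d : ℝ} (hd : 0 < d) (hu : d ≤ u) (hv : d ≤ v) :
    Real.log v + (u - v) / v - (u - v) ^ 2 / (2 * d ^ 2) ≤ Real.log u := by
  have hu0 := hd.trans_le hu
  have hv0 := hd.trans_le hv
  have hlog : Real.log u = Real.log v + Real.log (u / v) := by
    rw [Real.log_div hu0.ne' hv0.ne']; ring
  rw [hlog]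
  have hr : (u - v) / v = u / v - 1 := by field_simp
  -- To the right of `v` the second-order bound has curvature `1/v²`, at most `1/d²`. To the left,
  -- `ln s ≥ (s - 1/s)/2` makes the gap exactly `(u - v)² / (2uv)`, and `uv ≥ d²`.
  rcases le_total v u with h | h
  · have h1 := sub_half_sq_le_log (s := u / v) ((one_le_div hv0).2 h)
    have h2 : (u / v - 1) ^ 2 / 2 ≤ (u - v) ^ 2 / (2 * d ^ 2) := by
      rw [← hr, div_pow, div_div, mul_comm]
      gcongr
    linarith
  · have h1 := half_sub_inv_le_log (div_pos hu0 hv0) ((div_le_one hv0).2 h)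
    have h2 : (u / v - 1) - (u / v - (u / v)⁻¹) / 2 ≤ (u - v) ^ 2 / (2 * d ^ 2) := by
      have : (u / v - 1) - (u / v - (u / v)⁻¹) / 2 = (u - v) ^ 2 / (2 * (u * v)) := by
        field_simp; ring
      rw [this]
      gcongr
      nlinarith
    linarith

/-- Second-order expansion of the log wealth around the stationary fraction `b`: the linear terms
sum to zero by `h0`, and every factor stays above `d`, which bounds the curvature by `1/d²`. -/
theorem prod_exp_le_prod {b u d : ℝ} (hd : 0 < d) (hu : ∀ i < t, d ≤ 1 + u * a i)
    (hb : ∀ i < t, d ≤ 1 + b * a i)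
    (h0 : ∑ i ∈ Finset.range t, a i / (1 + b * a i) = 0) :
    (∏ i ∈ Finset.range t, (1 + b * a i))
        * Real.exp (-((b - u) ^ 2 * ∑ i ∈ Finset.range t, a i ^ 2) / (2 * d ^ 2))
      ≤ ∏ i ∈ Finset.range t, (1 + u * a i) := by
  have hu0 : ∀ i ∈ Finset.range t, 0 < 1 + u * a i :=
    fun i hi => hd.trans_le (hu i (Finset.mem_range.1 hi))
  have hb0 : ∀ i ∈ Finset.range t, 0 < 1 + b * a i :=
    fun i hi => hd.trans_le (hb i (Finset.mem_range.1 hi))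
  rw [← Real.log_le_log_iff (mul_pos (Finset.prod_pos hb0) (Real.exp_pos _))
    (Finset.prod_pos hu0), Real.log_mul (Finset.prod_pos hb0).ne' (Real.exp_ne_zero _),
    Real.log_exp, Real.log_prod (fun i hi => (hb0 i hi).ne'),
    Real.log_prod (fun i hi => (hu0 i hi).ne')]
  calc _ = ∑ i ∈ Finset.range t, (Real.log (1 + b * a i)
        + ((1 + u * a i) - (1 + b * a i)) / (1 + b * a i)
        - ((1 + u * a i) - (1 + b * a i)) ^ 2 / (2 * d ^ 2)) := by
        rw [Finset.sum_sub_distrib, Finset.sum_add_distrib]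
        have h1 : ∑ i ∈ Finset.range t, ((1 + u * a i) - (1 + b * a i)) / (1 + b * a i)
            = (u - b) * ∑ i ∈ Finset.range t, a i / (1 + b * a i) := by
          rw [Finset.mul_sum]
          refine Finset.sum_congr rfl fun i _ => ?_
          rw [mul_div_assoc']; congr 1; ring
        have h2 : ∑ i ∈ Finset.range t, ((1 + u * a i) - (1 + b * a i)) ^ 2 / (2 * d ^ 2)
            = ((b - u) ^ 2 * ∑ i ∈ Finset.range t, a i ^ 2) / (2 * d ^ 2) := by
          rw [Finset.mul_sum, Finset.sum_div]
          refine Finset.sum_congr rfl fun i _ => ?_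
          congr 1; ring
        rw [h1, h2, h0]
        ring
    _ ≤ _ := Finset.sum_le_sum fun i hi => log_quadratic_lower hd
        (hu i (Finset.mem_range.1 hi)) (hb i (Finset.mem_range.1 hi))

/-! ### First-order conditions at the best fraction. -/

theorem hasDerivAt_sum_log {b : ℝ} (hb : ∀ i < t, 0 < 1 + b * a i) :
    HasDerivAt (fun u => ∑ i ∈ Finset.range t, Real.log (1 + u * a i))
      (∑ i ∈ Finset.range t, a i / (1 + b * a i)) b := by
  refine HasDerivAt.fun_sum fun i hi => ?_
  have := (((hasDerivAt_id b).mul_const (a i)).const_add 1).log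
    (hb i (Finset.mem_range.1 hi)).ne'
  simpa using this

theorem pos_of_one_le_prod (ha : ∀ i < t, |a i| ≤ 1) {b : ℝ} (hb : |b| ≤ 1)
    (hw : 1 ≤ ∏ i ∈ Finset.range t, (1 + b * a i)) : ∀ i < t, 0 < 1 + b * a i := by
  intro i hi
  refine lt_of_le_of_ne (one_add_mul_nonneg hb (ha i hi)) fun h => ?_
  rw [Finset.prod_eq_zero (Finset.mem_range.2 hi) h.symm] at hw
  linarith

theorem one_le_prod_of_isMaxOn {b : ℝ}
    (hmax : IsMaxOn (fun u => ∏ i ∈ Finset.range t, (1 + u * a i)) (Set.Icc (-1) 1) b) :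
    1 ≤ ∏ i ∈ Finset.range t, (1 + b * a i) := by
  simpa using hmax (show (0 : ℝ) ∈ Set.Icc (-1) 1 by norm_num)

/-- Only a one-sided condition survives when the maximizer may be the endpoint `1`: slopes from the
left are nonnegative at a maximum. -/
theorem deriv_nonneg_of_isMaxOn (ha : ∀ i < t, |a i| ≤ 1) {b : ℝ} (hb0 : 0 < b) (hb1 : b ≤ 1)
    (hmax : IsMaxOn (fun u => ∏ i ∈ Finset.range t, (1 + u * a i)) (Set.Icc (-1) 1) b) :
    0 ≤ ∑ i ∈ Finset.range t, a i / (1 + b * a i) := by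
  have hpos := pos_of_one_le_prod ha (by rw [abs_of_pos hb0]; exact hb1)
    (one_le_prod_of_isMaxOn hmax)
  have hd := (hasDerivAt_sum_log hpos).hasDerivWithinAt (s := Set.Iio b)
  rw [hasDerivWithinAt_iff_tendsto_slope' (by simp)] at hd
  refine ge_of_tendsto hd ?_
  filter_upwards [Ioo_mem_nhdsLT hb0] with u hu
  have hpu : ∀ i ∈ Finset.range t, 0 < 1 + u * a i := fun i hi => by
    have h1 := (abs_le.1 (ha i (Finset.mem_range.1 hi))).1
    nlinarith [hu.1, hu.2, hb1]
  rw [slope_def_field]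
  refine div_nonneg_of_nonpos ?_ (by linarith [hu.2])
  rw [sub_nonpos, ← Real.log_prod (fun i hi => (hpu i hi).ne'),
    ← Real.log_prod (fun i hi => (hpos i (Finset.mem_range.1 hi)).ne')]
  exact Real.log_le_log (Finset.prod_pos hpu) (hmax ⟨by linarith [hu.1], by linarith [hu.2]⟩)

theorem deriv_eq_zero_of_isMaxOn (ha : ∀ i < t, |a i| ≤ 1) {b : ℝ} (hb0 : 0 < b) (hb1 : b < 1)
    (hmax : IsMaxOn (fun u => ∏ i ∈ Finset.range t, (1 + u * a i)) (Set.Icc (-1) 1) b) :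
    ∑ i ∈ Finset.range t, a i / (1 + b * a i) = 0 := by
  have hpos := pos_of_one_le_prod ha (by rw [abs_of_pos hb0]; exact hb1.le)
    (one_le_prod_of_isMaxOn hmax)
  refine IsLocalMax.hasDerivAt_eq_zero ?_ (hasDerivAt_sum_log hpos)
  filter_upwards [Ioo_mem_nhds hb0 hb1] with u hu
  have hpu : ∀ i ∈ Finset.range t, 0 < 1 + u * a i := fun i hi => by
    have h1 := (abs_le.1 (ha i (Finset.mem_range.1 hi))).1
    nlinarith [hu.1, hu.2]
  rw [← Real.log_prod (fun i hi => (hpu i hi).ne'),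
    ← Real.log_prod (fun i hi => (hpos i (Finset.mem_range.1 hi)).ne')]
  exact Real.log_le_log (Finset.prod_pos hpu) (hmax ⟨by linarith [hu.1], by linarith [hu.2]⟩)

theorem intervalIntegrable_mul_F {g : ℝ → ℝ} (hg : Continuous g) {l b : ℝ} (hl : -1 ≤ l)
    (hl' : l ≤ b) (hb : b ≤ 1) : IntervalIntegrable (fun u => g u * F u) volume l b := by
  refine IntervalIntegrable.continuousOn_mul ?_ hg.continuousOn
  refine intervalIntegrable_F.mono_set ?_
  rw [Set.uIcc_of_le hl', Set.uIcc_of_le (by norm_num)]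
  exact Set.Icc_subset_Icc hl hb

/-- `F b` is the minimum of the density on `(0, b]`, and the rest of `[-1, 1]` contributes a
nonnegative amount. -/
theorem integral_mul_F_le (ha : ∀ i < t, |a i| ≤ 1) {l b : ℝ} (hl : 0 ≤ l) (hlb : l ≤ b)
    (hb : b ≤ 1) :
    (∫ u in l..b, ∏ i ∈ Finset.range t, (1 + u * a i)) * F b
      ≤ ∫ u in (-1 : ℝ)..1, (∏ i ∈ Finset.range t, (1 + u * a i)) * F u := by
  have hc := continuous_prod a t
  calc _ = ∫ u in l..b, (∏ i ∈ Finset.range t, (1 + u * a i)) * F b := by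
        rw [intervalIntegral.integral_mul_const]
    _ ≤ ∫ u in l..b, (∏ i ∈ Finset.range t, (1 + u * a i)) * F u := by
        -- The comparison uses the open interval because `F 0` has the default value `0`, which
        -- would break `F b ≤ F u` at `u = 0`.
        refine intervalIntegral.integral_mono_on_of_le_Ioo hlb
          ((hc.mul continuous_const).intervalIntegrable _ _)
          (intervalIntegrable_mul_F hc (by linarith) hlb hb) fun u hu => ?_
        have hu0 : 0 < u := by linarith [hu.1]
        refine mul_le_mul_of_nonneg_left (F_anti hu0 hu.2.le hb)
          (prod_nonneg_of_abs_le ha ?_)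
        rw [abs_of_pos hu0]; linarith [hu.2]
    _ ≤ _ := by
        refine intervalIntegral.integral_mono_interval (by linarith) hlb hb ?_
          (intervalIntegrable_mul_F hc le_rfl (by norm_num) le_rfl)
        refine (ae_restrict_iff' measurableSet_Ioc).2 (ae_of_all _ fun u hu => ?_)
        have : |u| ≤ 1 := abs_le.2 ⟨hu.1.le, hu.2⟩
        exact mul_nonneg (prod_nonneg_of_abs_le ha this) (F_nonneg this)

theorem integral_mul_F_neg (g : ℝ → ℝ) :
    ∫ u in (-1 : ℝ)..1, g (-u) * F u = ∫ u in (-1 : ℝ)..1, g u * F u := by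
  have := intervalIntegral.integral_comp_neg (a := -1) (b := 1) (fun u => g u * F u)
  simpa [F_neg] using this

end Betting

/-! ### Regret of the mixture strategy -/

/-- The coins `x i - m`, with the sign of the best betting fraction. -/
def coin (x : ℕ → ℝ) (t : ℕ) (m : ℝ) (i : ℕ) : ℝ := Real.sign (betaStar x t m) * (x i - m)

section Regret

variable {x : ℕ → ℝ} {t : ℕ} {m : ℝ}

theorem abs_sub_le_one (hx : ∀ i, x i ∈ Set.Icc (0 : ℝ) 1) (hm : m ∈ Set.Icc (0 : ℝ) 1) (i : ℕ) :
    |x i - m| ≤ 1 :=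
  abs_le.2 ⟨by linarith [(hx i).1, hm.2], by linarith [(hx i).2, hm.1]⟩

theorem abs_coin_le_one (hx : ∀ i, x i ∈ Set.Icc (0 : ℝ) 1) (hm : m ∈ Set.Icc (0 : ℝ) 1)
    (i : ℕ) : |coin x t m i| ≤ 1 := by
  unfold coin
  rw [abs_mul]
  refine mul_le_one₀ ?_ (abs_nonneg _) (abs_sub_le_one hx hm i)
  rcases Real.sign_apply_eq (betaStar x t m) with h | h | h <;> simp [h]

theorem betaStar_mem : betaStar x t m ∈ Set.Icc (-1 : ℝ) 1 := (exists_best x t m).choose_spec.1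

theorem abs_betaStar_le_one : |betaStar x t m| ≤ 1 := abs_le.2 betaStar_mem

theorem isMaxOn_betaStar : IsMaxOn (wealth x t m) (Set.Icc (-1) 1) (betaStar x t m) :=
  (exists_best x t m).choose_spec.2

theorem wealth_le_wealthStar {β : ℝ} (hβ : β ∈ Set.Icc (-1 : ℝ) 1) :
    wealth x t m β ≤ wealthStar x t m := isMaxOn_betaStar hβ

theorem one_le_wealthStar : 1 ≤ wealthStar x t m := by
  simpa [wealth] using wealth_le_wealthStar (x := x) (t := t) (m := m) (β := 0) (by norm_num)

theorem wealthStar_pos : 0 < wealthStar x t m := zero_lt_one.trans_le one_le_wealthStar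

theorem sign_mul_self {β : ℝ} (h0 : β ≠ 0) : Real.sign β * Real.sign β = 1 := by
  rcases Real.sign_apply_eq_of_ne_zero β h0 with h | h <;> simp [h]

theorem prod_coin (u : ℝ) :
    ∏ i ∈ Finset.range t, (1 + u * coin x t m i)
      = wealth x t m (Real.sign (betaStar x t m) * u) := by
  unfold wealth coin
  refine Finset.prod_congr rfl fun i _ => ?_
  ring

theorem prod_coin_abs (h0 : betaStar x t m ≠ 0) :
    ∏ i ∈ Finset.range t, (1 + |betaStar x t m| * coin x t m i) = wealthStar x t m := by
  rw [prod_coin, wealthStar]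
  congr 1
  rcases lt_or_gt_of_ne h0 with h | h
  · rw [Real.sign_of_neg h, abs_of_neg h]; ring
  · rw [Real.sign_of_pos h, abs_of_pos h]; ring

theorem isMaxOn_prod_coin (h0 : betaStar x t m ≠ 0) :
    IsMaxOn (fun u => ∏ i ∈ Finset.range t, (1 + u * coin x t m i)) (Set.Icc (-1) 1)
      |betaStar x t m| := by
  intro u hu
  simp only [Set.mem_ofPred_eq]
  rw [prod_coin_abs h0, prod_coin]
  refine wealth_le_wealthStar ?_
  have h1 := hu.1
  have h2 := hu.2
  rcases Real.sign_apply_eq_of_ne_zero _ h0 with h | h <;> rw [h] <;> constructor <;> linarith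

theorem mixtureWealth_eq_coin (h0 : betaStar x t m ≠ 0) :
    mixtureWealth x t m
      = ∫ u in (-1 : ℝ)..1, (∏ i ∈ Finset.range t, (1 + u * coin x t m i)) * F u := by
  unfold mixtureWealth
  simp only [prod_coin]
  rcases Real.sign_apply_eq_of_ne_zero _ h0 with h | h <;> rw [h]
  · simpa using (integral_mul_F_neg (wealth x t m)).symm
  · simp

theorem V_eq_coin (h0 : betaStar x t m ≠ 0) :
    V x t m = ∑ i ∈ Finset.range t, coin x t m i ^ 2 := by
  unfold V coin
  refine Finset.sum_congr rfl fun i _ => ?_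
  rw [mul_pow, sq (Real.sign _), sign_mul_self h0, one_mul]

theorem d_le_of_coin {i : ℕ} (hi : i < t) {u : ℝ} (hu0 : 0 ≤ u) (hu : u ≤ |betaStar x t m|) :
    d x t m ≤ 1 + u * coin x t m i := by
  have hq : q x t m ≤ coin x t m i := by
    refine (ciInf_le (Set.finite_range _).bddBelow (⟨i, hi⟩ : Fin t)).trans ?_
    simp [coin, mul_comm]
  unfold d
  gcongr
  rcases le_total 0 (coin x t m i) with h | h
  · exact (min_le_right _ _).trans (by positivity)
  · exact (min_le_left _ _).trans (by nlinarith [abs_nonneg (betaStar x t m)])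

/-- Coins are at least `-1`. In particular `d` is positive as soon as the best fraction is interior.
-/
theorem le_d (ht : 1 ≤ t) (hx : ∀ i, x i ∈ Set.Icc (0 : ℝ) 1) (hm : m ∈ Set.Icc (0 : ℝ) 1) :
    1 - |betaStar x t m| ≤ d x t m := by
  have : Nonempty (Fin t) := ⟨⟨0, ht⟩⟩
  have hq : -1 ≤ q x t m := le_ciInf fun i => by
    have := (abs_le.1 (abs_coin_le_one (t := t) hx hm i)).1
    rwa [coin, mul_comm] at this
  unfold d
  have := abs_nonneg (betaStar x t m)
  have : -|betaStar x t m| ≤ min (q x t m * |betaStar x t m|) 0 :=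
    le_min (by nlinarith) (by linarith)
  linarith

theorem logRatio_mul_le (hx : ∀ i, x i ∈ Set.Icc (0 : ℝ) 1)
    (hm : m ∈ Set.Icc (0 : ℝ) 1) (h0 : betaStar x t m ≠ 0) :
    wealthStar x t m * (logRatio (wealthStar x t m) * |betaStar x t m|) * F (betaStar x t m)
      ≤ mixtureWealth x t m := by
  have hb := abs_pos.2 h0
  have h1 := mul_logRatio_le_integral (fun i _ => abs_coin_le_one (t := t) hx hm i) hb
    abs_betaStar_le_one (by rw [prod_coin_abs h0]; exact one_le_wealthStar)
  have h2 := integral_mul_F_le (t := t) (fun i _ => abs_coin_le_one (t := t) hx hm i) le_rfl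
    hb.le abs_betaStar_le_one
  rw [mixtureWealth_eq_coin h0, ← F_abs]
  rw [prod_coin_abs h0] at h1
  exact (mul_le_mul_of_nonneg_right h1 (F_nonneg (by simpa using abs_betaStar_le_one))).trans h2

theorem V_nonneg : 0 ≤ V x t m := Finset.sum_nonneg fun _ _ => sq_nonneg _

/-- The Gaussian lower bound is integrated over an interval of length `Delta` ending at `|β*|`, and
the exponential is replaced by its smallest value there. At the boundary `|β*| = 1` the first-order
condition can fail, which is why `Delta` vanishes in that case. -/
theorem exp_mul_Delta_le (ht : 1 ≤ t) (hx : ∀ i, x i ∈ Set.Icc (0 : ℝ) 1)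
    (hm : m ∈ Set.Icc (0 : ℝ) 1) (h0 : betaStar x t m ≠ 0) :
    wealthStar x t m
        * (Real.exp (-(Delta x t m ^ 2 * V x t m) / (2 * d x t m ^ 2)) * Delta x t m)
        * F (betaStar x t m) ≤ mixtureWealth x t m := by
  have hb := abs_pos.2 h0
  have ha : ∀ i < t, |coin x t m i| ≤ 1 := fun i _ => abs_coin_le_one (t := t) hx hm i
  rcases abs_betaStar_le_one.lt_or_eq (a := |betaStar x t m|) with h1 | h1
  · have hd : 0 < d x t m := by linarith [le_d ht hx hm]
    have hdt : 0 ≤ deltaTilde x t m := by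
      unfold deltaTilde
      rw [if_pos h1]; positivity
    obtain ⟨l, hl⟩ : ∃ l, l = max (|betaStar x t m| - deltaTilde x t m) 0 := ⟨_, rfl⟩
    have hl0 : 0 ≤ l := hl ▸ le_max_right _ _
    have hlb : l ≤ |betaStar x t m| := hl ▸ max_le (by linarith) hb.le
    have hD : Delta x t m = |betaStar x t m| - l := by rw [hl]; rfl
    have h2 := integral_mul_F_le (t := t) ha hl0 hlb abs_betaStar_le_one
    rw [← mixtureWealth_eq_coin h0, F_abs] at h2
    refine le_trans (mul_le_mul_of_nonneg_right ?_ (F_nonneg abs_betaStar_le_one)) h2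
    calc _ = ∫ u in l..|betaStar x t m|, wealthStar x t m
          * Real.exp (-(Delta x t m ^ 2 * V x t m) / (2 * d x t m ^ 2)) := by
          rw [intervalIntegral.integral_const, hD, smul_eq_mul]; ring
      _ ≤ _ := by
          refine intervalIntegral.integral_mono_on hlb intervalIntegrable_const
            ((continuous_prod _ _).intervalIntegrable _ _) fun u hu => ?_
          have h3 := prod_exp_le_prod (a := coin x t m) (u := u) hd
            (fun i hi => d_le_of_coin hi (hl0.trans hu.1) hu.2)
            (fun i hi => d_le_of_coin hi hb.le le_rfl)
            (deriv_eq_zero_of_isMaxOn ha hb h1 (isMaxOn_prod_coin h0))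
          rw [prod_coin_abs h0, ← V_eq_coin h0] at h3
          refine le_trans ?_ h3
          have := wealthStar_pos (x := x) (t := t) (m := m)
          have := V_nonneg (x := x) (t := t) (m := m)
          have : 0 ≤ |betaStar x t m| - u := by linarith [hu.2]
          have : |betaStar x t m| - u ≤ Delta x t m := by rw [hD]; linarith [hu.1]
          gcongr
  · have hD : Delta x t m = 0 := by
      simp [Delta, deltaTilde, h1]
    rw [hD]
    simp only [mul_zero, zero_mul]
    -- On the degenerate interval `l = b = 0` the bound reduces to nonnegativity of the mixture.
    have h2 := integral_mul_F_le (t := t) ha (le_refl 0) le_rfl zero_le_one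
    rw [← mixtureWealth_eq_coin h0] at h2
    simpa using h2

/-- The reciprocal of the regret bound on the multiplicative scale. -/
def invR (x : ℕ → ℝ) (t : ℕ) (m : ℝ) : ℝ :=
  max (logRatio (wealthStar x t m) * |betaStar x t m|)
    (Real.exp (-(Delta x t m ^ 2 * V x t m) / (2 * d x t m ^ 2)) * Delta x t m)
      * F (betaStar x t m)

theorem R_eq : R x t m = 1 / ENNReal.ofReal (invR x t m) := rfl

theorem logRatio_pos {w : ℝ} (hw : 1 ≤ w) : 0 < logRatio w := by
  rcases hw.eq_or_lt with rfl | hw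
  · simp [logRatio]
  · rw [logRatio, if_neg hw.ne']
    exact div_pos (by rw [sub_pos, div_lt_one (by linarith)]; exact hw) (Real.log_pos hw)

theorem invR_pos (h0 : betaStar x t m ≠ 0) : 0 < invR x t m :=
  mul_pos (lt_max_of_lt_left (mul_pos (logRatio_pos one_le_wealthStar) (abs_pos.2 h0)))
    (F_pos h0 abs_betaStar_le_one)

theorem wealthStar_mul_invR_le (ht : 1 ≤ t) (hx : ∀ i, x i ∈ Set.Icc (0 : ℝ) 1)
    (hm : m ∈ Set.Icc (0 : ℝ) 1) (h0 : betaStar x t m ≠ 0) :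
    wealthStar x t m * invR x t m ≤ mixtureWealth x t m := by
  unfold invR
  rw [← mul_assoc, mul_max_of_nonneg _ _ wealthStar_pos.le,
    max_mul_of_nonneg _ _ (F_nonneg abs_betaStar_le_one)]
  exact max_le (logRatio_mul_le hx hm h0) (exp_mul_Delta_le ht hx hm h0)

/-- The default value `F 0 = 0` makes the denominator vanish, so the extended division returns the
intended infinite value. -/
theorem R_eq_top (h0 : betaStar x t m = 0) : R x t m = ⊤ := by
  simp [R, h0, F_zero]

theorem R_eq_ofReal (h0 : betaStar x t m ≠ 0) : R x t m = ENNReal.ofReal (1 / invR x t m) := by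
  rw [R_eq, ENNReal.ofReal_div_of_pos (invR_pos h0), ENNReal.ofReal_one]

theorem regret_le_log_R (ht : 1 ≤ t) (hx : ∀ i, x i ∈ Set.Icc (0 : ℝ) 1)
    (hm : m ∈ Set.Icc (0 : ℝ) 1) : (regret x t m : EReal) ≤ ENNReal.log (R x t m) := by
  by_cases h0 : betaStar x t m = 0
  · rw [R_eq_top h0]; simp
  · have hi := invR_pos h0
    have hw := wealthStar_pos (x := x) (t := t) (m := m)
    have h1 := wealthStar_mul_invR_le ht hx hm h0
    rw [R_eq_ofReal h0, ENNReal.log_ofReal, if_neg (not_le.2 (by positivity))]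
    rw [EReal.coe_le_coe_iff]
    have h2 := Real.log_le_log (by positivity) h1
    rw [Real.log_mul hw.ne' hi.ne'] at h2
    rw [one_div, Real.log_inv, regret]
    linarith

theorem mem_accepted_of_betaStar_eq_zero {δ : ℝ} (h0 : betaStar x t m = 0) :
    m ∈ accepted δ x t := by
  show (_ : ℝ≥0∞) ≤ _
  rw [R_eq_top h0, ENNReal.top_div]
  simp

theorem mem_accepted_iff {δ : ℝ} (hδ : 0 < δ) (h0 : betaStar x t m ≠ 0) :
    m ∈ accepted δ x t ↔ wealthStar x t m * invR x t m ≤ 1 / δ := by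
  show (_ : ℝ≥0∞) ≤ _ ↔ _
  have hi := invR_pos h0
  rw [R_eq_ofReal h0, ← ENNReal.ofReal_div_of_pos hδ, ENNReal.ofReal_le_ofReal_iff (by positivity),
    div_div, mul_comm (invR x t m) δ, ← div_div, le_div_iff₀ hi]

theorem mem_accepted_of_mixtureWealth_le {δ : ℝ} (hδ : 0 < δ) (ht : 1 ≤ t)
    (hx : ∀ i, x i ∈ Set.Icc (0 : ℝ) 1) (hm : m ∈ Set.Icc (0 : ℝ) 1)
    (h : mixtureWealth x t m ≤ 1 / δ) : m ∈ accepted δ x t := by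
  by_cases h0 : betaStar x t m = 0
  · exact mem_accepted_of_betaStar_eq_zero h0
  · exact (mem_accepted_iff hδ h0).2 ((wealthStar_mul_invR_le ht hx hm h0).trans h)

theorem continuous_wealth : Continuous (wealth x t m) := by unfold wealth; fun_prop

theorem mixtureWealth_le_wealthStar : mixtureWealth x t m ≤ wealthStar x t m := by
  calc mixtureWealth x t m ≤ ∫ β in (-1 : ℝ)..1, wealthStar x t m * F β := by
        refine intervalIntegral.integral_mono_on (by norm_num)
          (intervalIntegrable_mul_F continuous_wealth le_rfl (by norm_num) le_rfl)
          (intervalIntegrable_F.const_mul _) fun β hβ => ?_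
        exact mul_le_mul_of_nonneg_right (wealth_le_wealthStar hβ) (F_nonneg (abs_le.2 hβ))
    _ = wealthStar x t m := by
        rw [intervalIntegral.integral_const_mul, integral_F, mul_one]

theorem wealth_le_exp (hx : ∀ i, x i ∈ Set.Icc (0 : ℝ) 1) (hm : m ∈ Set.Icc (0 : ℝ) 1)
    {β : ℝ} (hβ : |β| ≤ 1) :
    wealth x t m β ≤ Real.exp (β * ∑ i ∈ Finset.range t, (x i - m)) := by
  unfold wealth
  rw [Finset.mul_sum, Real.exp_sum]
  refine Finset.prod_le_prod (fun i _ => one_add_mul_nonneg hβ (abs_sub_le_one hx hm i))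
    fun i _ => ?_
  linarith [Real.add_one_le_exp (β * (x i - m))]

theorem muHat_mem (hx : ∀ i, x i ∈ Set.Icc (0 : ℝ) 1) (t : ℕ) :
    muHat x t ∈ Set.Icc (0 : ℝ) 1 := by
  refine ⟨div_nonneg (Finset.sum_nonneg fun i _ => (hx i).1) (by positivity),
    div_le_one_of_le₀ ?_ (by positivity)⟩
  calc ∑ i ∈ Finset.range t, x i ≤ ∑ i ∈ Finset.range t, (1 : ℝ) :=
        Finset.sum_le_sum fun i _ => (hx i).2
    _ = t := by simp

theorem sum_sub_eq (ht : 1 ≤ t) (x : ℕ → ℝ) (m : ℝ) :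
    ∑ i ∈ Finset.range t, (x i - m) = t * (muHat x t - m) := by
  have : (t : ℝ) ≠ 0 := by positivity
  rw [Finset.sum_sub_distrib, muHat]
  simp
  field_simp

/-- At the empirical mean the deviations sum to zero, so `1 + y ≤ e^y` shows that no fraction earns
anything. This keeps the sets defining `mLow` and `mUp` nonempty. -/
theorem muHat_mem_accepted {δ : ℝ} (hδ : δ ∈ Set.Ioo (0 : ℝ) 1) (ht : 1 ≤ t)
    (hx : ∀ i, x i ∈ Set.Icc (0 : ℝ) 1) : muHat x t ∈ accepted δ x t := by
  have hm := muHat_mem hx t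
  refine mem_accepted_of_mixtureWealth_le hδ.1 ht hx hm ?_
  refine mixtureWealth_le_wealthStar.trans ?_
  have := wealth_le_exp (t := t) hx hm (abs_betaStar_le_one (x := x) (t := t) (m := muHat x t))
  rw [sum_sub_eq ht, sub_self, mul_zero, mul_zero, Real.exp_zero] at this
  refine this.trans ?_
  rw [le_div_iff₀ hδ.1]; linarith [hδ.2]

end Regret

/-! ### Coverage of the confidence sequence -/

/-- Ville's inequality: Doob's maximal inequality holds up to each finite horizon with a bound free
of the horizon, since the mean is constant, and the events increase to the full one. -/
theorem measure_exists_gt_le {Ω : Type*} [m0 : MeasurableSpace Ω] {P : Measure Ω}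
    [IsProbabilityMeasure P] {𝒢 : Filtration ℕ m0} {f : ℕ → Ω → ℝ} (hf : Martingale f 𝒢 P)
    (h0 : 0 ≤ f) (h1 : ∫ ω, f 0 ω ∂P ≤ 1) {δ : ℝ} (hδ : 0 < δ) :
    P {ω | ∃ t, 1 / δ < f t ω} ≤ ENNReal.ofReal δ := by
  have hmono : Monotone fun n : ℕ => {ω | ∃ t ≤ n, 1 / δ < f t ω} := by
    rintro n k hnk ω ⟨t, ht, h⟩
    exact ⟨t, ht.trans hnk, h⟩
  have hU : {ω | ∃ t, 1 / δ < f t ω} = ⋃ n : ℕ, {ω | ∃ t ≤ n, 1 / δ < f t ω} := by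
    ext ω
    simp only [Set.mem_ofPred_eq, Set.mem_iUnion]
    exact ⟨fun ⟨t, h⟩ => ⟨t, t, le_rfl, h⟩, fun ⟨_, t, _, h⟩ => ⟨t, h⟩⟩
  rw [hU, hmono.measure_iUnion]
  refine iSup_le fun n => ?_
  have hmax := maximal_ineq hf.submartingale h0 (ε := (1 / δ).toNNReal) n
  rw [Real.coe_toNNReal _ (by positivity)] at hmax
  have hE : ∫ ω, f n ω ∂P ≤ 1 := by
    have := hf.setIntegral_eq (Nat.zero_le n) (MeasurableSet.univ)
    simp only [setIntegral_univ] at this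
    linarith
  have hint : ENNReal.ofReal (∫ ω in {ω | (1 / δ) ≤ (Finset.range (n + 1)).sup'
      Finset.nonempty_range_add_one fun k => f k ω}, f n ω ∂P) ≤ 1 := by
    rw [← ENNReal.ofReal_one]
    refine ENNReal.ofReal_le_ofReal (le_trans ?_ hE)
    exact setIntegral_le_integral (hf.integrable n) (ae_of_all _ (h0 n))
  have h2 := hmax.trans hint
  have h3 : P {ω | ∃ t ≤ n, 1 / δ < f t ω} ≤ P {ω | (1 / δ) ≤ (Finset.range (n + 1)).sup'
      Finset.nonempty_range_add_one fun k => f k ω} := by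
    refine measure_mono ?_
    rintro ω ⟨t, ht, h⟩
    exact h.le.trans (Finset.le_sup' (fun k => f k ω) (Finset.mem_range.2 (by omega)))
  refine h3.trans ?_
  have h4 : ((1 / δ).toNNReal : ℝ≥0∞) = (ENNReal.ofReal δ)⁻¹ := by
    rw [← ENNReal.ofReal_inv_of_pos hδ, ← one_div, ENNReal.ofReal]
  rw [h4] at h2
  have hδ' : ENNReal.ofReal δ ≠ 0 := by simpa using hδ
  rw [mul_comm, ← div_eq_mul_inv, ENNReal.div_le_iff hδ' ENNReal.ofReal_ne_top, one_mul] at h2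
  exact h2

theorem measurable_F : Measurable F := by
  unfold F h
  simp only [← Real.norm_eq_abs]
  fun_prop

theorem stronglyMeasurable_integral_wealth {Ω : Type*} [inst : MeasurableSpace Ω]
    {Y : ℕ → Ω → ℝ} {t : ℕ} (hY : ∀ i < t, Measurable (Y i)) (m : ℝ) {g : ℝ → ℝ} (hg : Measurable g) :
    StronglyMeasurable fun ω =>
      ∫ β in (-1 : ℝ)..1, wealth (fun i => Y i ω) t m β * g β := by
  simp only [intervalIntegral.integral_of_le (show (-1 : ℝ) ≤ 1 by norm_num)]
  refine StronglyMeasurable.integral_prod_right'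
    (f := fun p : Ω × ℝ => wealth (fun i => Y i p.1) t m p.2 * g p.2) ?_
  refine Measurable.stronglyMeasurable ?_
  refine Measurable.mul ?_ (hg.comp measurable_snd)
  unfold wealth
  refine Finset.measurable_fun_prod _ fun i hi => ?_
  have := (hY i (Finset.mem_range.1 hi)).comp (measurable_fst : Measurable (Prod.fst : Ω × ℝ → Ω))
  exact measurable_const.add (measurable_snd.mul (this.sub measurable_const))

section Increments

variable {x : ℕ → ℝ} {t : ℕ} {m : ℝ}

theorem abs_wealth_le (hx : ∀ i, x i ∈ Set.Icc (0 : ℝ) 1) (hm : m ∈ Set.Icc (0 : ℝ) 1)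
    {β : ℝ} (hβ : |β| ≤ 1) : |wealth x t m β| ≤ 2 ^ t := by
  unfold wealth
  rw [Finset.abs_prod]
  calc _ ≤ ∏ i ∈ Finset.range t, (2 : ℝ) := by
        refine Finset.prod_le_prod (fun _ _ => abs_nonneg _) fun i _ => ?_
        have : |β * (x i - m)| ≤ 1 := by
          rw [abs_mul]; exact mul_le_one₀ hβ (abs_nonneg _) (abs_sub_le_one hx hm i)
        rw [abs_le] at *
        constructor <;> linarith
    _ = 2 ^ t := by simp

/-- A general weight `g` is allowed because both `F β` (the wealth) and `β * F β` (the aggregate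
bet) are needed. -/
theorem abs_integral_wealth_le (hx : ∀ i, x i ∈ Set.Icc (0 : ℝ) 1) (hm : m ∈ Set.Icc (0 : ℝ) 1)
    {g : ℝ → ℝ} (hg : ∀ β, |β| ≤ 1 → |g β| ≤ F β) :
    |∫ β in (-1 : ℝ)..1, wealth x t m β * g β| ≤ 2 ^ t := by
  rw [← Real.norm_eq_abs]
  calc _ ≤ ∫ β in (-1 : ℝ)..1, 2 ^ t * F β := by
        refine intervalIntegral.norm_integral_le_of_norm_le (by norm_num)
          (ae_of_all _ fun β hβ => ?_) (intervalIntegrable_F.const_mul _)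
        have hβ' : |β| ≤ 1 := abs_le.2 ⟨hβ.1.le, hβ.2⟩
        rw [norm_mul]
        exact mul_le_mul (abs_wealth_le hx hm hβ') (hg β hβ') (norm_nonneg _) (by positivity)
    _ = 2 ^ t := by rw [intervalIntegral.integral_const_mul, integral_F, mul_one]

theorem mixtureWealth_succ (x : ℕ → ℝ) (t : ℕ) (m : ℝ) :
    mixtureWealth x (t + 1) m = mixtureWealth x t m
      + (∫ β in (-1 : ℝ)..1, wealth x t m β * (β * F β)) * (x t - m) := by
  unfold mixtureWealth
  have h1 := intervalIntegrable_mul_F (continuous_wealth (x := x) (t := t) (m := m))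
    (le_refl (-1)) (by norm_num) (le_refl 1)
  have h2 := intervalIntegrable_mul_F ((continuous_wealth (x := x) (t := t) (m := m)).mul
    continuous_id) (le_refl (-1)) (by norm_num) (le_refl 1)
  rw [← intervalIntegral.integral_mul_const, ← intervalIntegral.integral_add h1]
  · refine intervalIntegral.integral_congr fun β _ => ?_
    simp only [wealth, Finset.prod_range_succ]
    ring
  · refine (h2.mul_const (x t - m)).congr fun β _ => ?_
    simp only [Pi.mul_apply, id, mul_assoc]

theorem mixtureWealth_nonneg (hx : ∀ i, x i ∈ Set.Icc (0 : ℝ) 1) (hm : m ∈ Set.Icc (0 : ℝ) 1) :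
    0 ≤ mixtureWealth x t m := by
  refine intervalIntegral.integral_nonneg (by norm_num) fun β hβ => ?_
  have hβ' := abs_le.2 hβ
  exact mul_nonneg (Finset.prod_nonneg fun i _ =>
    one_add_mul_nonneg hβ' (abs_sub_le_one hx hm i)) (F_nonneg hβ')

theorem mixtureWealth_zero : mixtureWealth x 0 m = 1 := by
  simp [mixtureWealth, wealth, integral_F]

end Increments

/-- By `mixtureWealth_succ` each increment is a bet known before the round, times `Y t - μ`. Bounded
coins make everything integrable, so the bet can be pulled out of the conditional expectation,
leaving zero. -/
theorem martingale_mixtureWealth {Ω : Type*} [m0 : MeasurableSpace Ω] {P : Measure Ω}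
    [IsProbabilityMeasure P] {𝒢 : Filtration ℕ m0} {Y : ℕ → Ω → ℝ} {μ : ℝ}
    (hμ : μ ∈ Set.Icc (0 : ℝ) 1) (hY : ∀ i ω, Y i ω ∈ Set.Icc (0 : ℝ) 1)
    (hmeas : ∀ i j, i < j → Measurable[𝒢 j] (Y i))
    (hcond : ∀ i, P[Y i | 𝒢 i] =ᵐ[P] fun _ => μ) :
    Martingale (fun t ω => mixtureWealth (fun i => Y i ω) t μ) 𝒢 P := by
  have hYm : ∀ i, Measurable (Y i) := fun i => (hmeas i (i + 1) (by omega)).mono (𝒢.le _) le_rfl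
  have hM : ∀ t, StronglyMeasurable[𝒢 t] fun ω => mixtureWealth (fun i => Y i ω) t μ := fun t =>
    stronglyMeasurable_integral_wealth (inst := 𝒢 t) (fun i hi => hmeas i t hi) μ measurable_F
  have hG : ∀ t, StronglyMeasurable[𝒢 t] fun ω =>
      ∫ β in (-1 : ℝ)..1, wealth (fun i => Y i ω) t μ β * (β * F β) := fun t =>
    stronglyMeasurable_integral_wealth (inst := 𝒢 t) (fun i hi => hmeas i t hi) μ
      (measurable_id.mul measurable_F)
  have hMint : ∀ t, Integrable (fun ω => mixtureWealth (fun i => Y i ω) t μ) P := fun t =>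
    Integrable.of_bound ((hM t).mono (𝒢.le t)).aestronglyMeasurable (2 ^ t)
      (ae_of_all _ fun ω => abs_integral_wealth_le (fun i => hY i ω) hμ
        fun β hβ => (abs_of_nonneg (F_nonneg hβ)).le)
  have hYint : ∀ i, Integrable (Y i) P := fun i =>
    Integrable.of_bound (hYm i).aestronglyMeasurable 1
      (ae_of_all _ fun ω => abs_le.2 ⟨by linarith [(hY i ω).1], (hY i ω).2⟩)
  refine martingale_nat hM hMint fun t => ?_
  obtain ⟨G, hGdef⟩ : ∃ G : Ω → ℝ, G = fun ω =>
      ∫ β in (-1 : ℝ)..1, wealth (fun i => Y i ω) t μ β * (β * F β) := ⟨_, rfl⟩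
  have hGm : StronglyMeasurable[𝒢 t] G := hGdef ▸ hG t
  have hcint : Integrable (fun ω => Y t ω - μ) P := (hYint t).sub (integrable_const μ)
  have hGint : Integrable (G * fun ω => Y t ω - μ) P := by
    refine hcint.bdd_mul (c := 2 ^ t) (hGm.mono (𝒢.le t)).aestronglyMeasurable
      (ae_of_all _ fun ω => ?_)
    rw [hGdef]
    refine abs_integral_wealth_le (fun i => hY i ω) hμ fun β hβ => ?_
    rw [abs_mul, abs_of_nonneg (F_nonneg hβ)]
    exact mul_le_of_le_one_left (F_nonneg hβ) hβ
  have hsucc : (fun ω => mixtureWealth (fun i => Y i ω) (t + 1) μ)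
      = (fun ω => mixtureWealth (fun i => Y i ω) t μ) + G * fun ω => Y t ω - μ := by
    ext ω
    simp only [Pi.add_apply, Pi.mul_apply, hGdef]
    exact mixtureWealth_succ _ _ _
  have hzero : P[fun ω => Y t ω - μ | 𝒢 t] =ᵐ[P] fun _ => 0 := by
    have h1 := condExp_sub (hYint t) (integrable_const μ) (𝒢 t)
    rw [condExp_const (𝒢.le t)] at h1
    filter_upwards [h1, hcond t] with ω hω h2
    have : P[fun ω => Y t ω - μ | 𝒢 t] ω = P[Y t | 𝒢 t] ω - μ := hω
    rw [this, h2, sub_self]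
  simp only [hsucc]
  have h2 := condExp_add (hMint t) hGint (𝒢 t)
  rw [condExp_of_stronglyMeasurable (𝒢.le t) (hM t) (hMint t)] at h2
  filter_upwards [h2, condExp_mul_of_stronglyMeasurable_left hGm hGint hcint, hzero]
    with ω hω h3 h4
  rw [hω, Pi.add_apply, h3, Pi.mul_apply, h4, mul_zero, add_zero]

theorem mem_confidence_of_accepted {δ : ℝ} (hδ : δ ∈ Set.Ioo (0 : ℝ) 1) {x : ℕ → ℝ}
    (hx : ∀ i, x i ∈ Set.Icc (0 : ℝ) 1) {m : ℝ} (hm : m ∈ Set.Icc (0 : ℝ) 1)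
    (hacc : ∀ t, 1 ≤ t → m ∈ accepted δ x t) (t : ℕ) :
    m ∈ Set.Icc (lower δ x t) (upper δ x t) := by
  induction t with
  | zero => exact hm
  | succ t ih =>
    have hμ := muHat_mem_accepted hδ (t := t + 1) (by omega) hx
    have hμm := muHat_mem hx (t + 1)
    have ha := hacc (t + 1) (by omega)
    have hbb : BddBelow (Set.Icc 0 (muHat x (t + 1)) ∩ accepted δ x (t + 1)) :=
      ⟨0, fun y hy => hy.1.1⟩
    have hba : BddAbove (Set.Icc (muHat x (t + 1)) 1 ∩ accepted δ x (t + 1)) :=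
      ⟨1, fun y hy => hy.1.2⟩
    refine ⟨max_le ?_ ih.1, le_min ?_ ih.2⟩
    -- When `m` lies on the other side of the empirical mean, the accepted empirical mean itself
    -- bounds the infimum.
    · rcases le_total m (muHat x (t + 1)) with h | h
      · exact csInf_le hbb ⟨⟨hm.1, h⟩, ha⟩
      · exact (csInf_le hbb ⟨⟨hμm.1, le_rfl⟩, hμ⟩).trans h
    · rcases le_total m (muHat x (t + 1)) with h | h
      · exact h.trans (le_csSup hba ⟨⟨le_rfl, hμm.2⟩, hμ⟩)
      · exact le_csSup hba ⟨⟨h, hm.2⟩, ha⟩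

theorem coverage {δ : ℝ} (hδ : δ ∈ Set.Ioo (0 : ℝ) 1) {Ω : Type*} [m0 : MeasurableSpace Ω]
    (P : Measure Ω) [IsProbabilityMeasure P] (X : ℕ → Ω → ℝ) (μ : ℝ)
    (hX : ∀ i, Measurable (X i)) (hX01 : ∀ i, ∀ᵐ ω ∂P, X i ω ∈ Set.Icc (0 : ℝ) 1)
    (hcond : ∀ i, P[X i | ⨆ j < i, MeasurableSpace.comap (X j) inferInstance] =ᵐ[P] fun _ => μ) :
    P {ω | ¬ ∀ t : ℕ, 1 ≤ t → μ ∈ Set.Icc (lower δ (fun i => X i ω) t)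
      (upper δ (fun i => X i ω) t)} ≤ ENNReal.ofReal δ := by
  let 𝒢 : Filtration ℕ m0 :=
    { seq := fun i => ⨆ j < i, MeasurableSpace.comap (X j) inferInstance
      mono' := fun i k hik => biSup_mono fun j hj => lt_of_lt_of_le hj hik
      le' := fun i => iSup₂_le fun j _ => (hX j).comap_le }
  -- Clipping makes the bounds hold everywhere instead of almost surely; it changes each variable
  -- only on a null set and preserves adaptedness.
  let Y : ℕ → Ω → ℝ := fun i ω => max 0 (min (X i ω) 1)
  have hY : ∀ i ω, Y i ω ∈ Set.Icc (0 : ℝ) 1 := fun i ω =>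
    ⟨le_max_left _ _, max_le zero_le_one (min_le_right _ _)⟩
  have hYX : ∀ i, Y i =ᵐ[P] X i := fun i => by
    filter_upwards [hX01 i] with ω hω
    simp only [Y, min_eq_left hω.2, max_eq_right hω.1]
  have hmeas : ∀ i j, i < j → Measurable[𝒢 j] (Y i) := fun i j hij => by
    have h1 : Measurable[𝒢 j] (X i) :=
      (comap_measurable (X i)).mono (le_iSup₂_of_le i hij le_rfl) le_rfl
    exact measurable_const.max (h1.min measurable_const)
  have hcondY : ∀ i, P[Y i | 𝒢 i] =ᵐ[P] fun _ => μ := fun i =>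
    (condExp_congr_ae (hYX i)).trans (hcond i)
  have hμ : μ ∈ Set.Icc (0 : ℝ) 1 := by
    have hYint : Integrable (Y 0) P :=
      Integrable.of_bound ((hmeas 0 1 one_pos).mono (𝒢.le _) le_rfl).aestronglyMeasurable 1
        (ae_of_all _ fun ω => abs_le.2 ⟨by linarith [(hY 0 ω).1], (hY 0 ω).2⟩)
    have h1 : ∫ ω, Y 0 ω ∂P = μ := by
      rw [← integral_condExp (𝒢.le 0), integral_congr_ae (hcondY 0)]
      simp
    rw [← h1]
    refine ⟨integral_nonneg fun ω => (hY 0 ω).1, ?_⟩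
    calc _ ≤ ∫ _, (1 : ℝ) ∂P := integral_mono hYint (integrable_const 1) fun ω => (hY 0 ω).2
      _ = 1 := by simp
  have hville := measure_exists_gt_le (martingale_mixtureWealth hμ hY hmeas hcondY)
    (fun t ω => mixtureWealth_nonneg (fun i => hY i ω) hμ)
    (by simp [mixtureWealth_zero]) hδ.1
  refine le_trans (measure_mono_ae ?_) hville
  filter_upwards [ae_all_iff.2 hYX] with ω hω hbad
  by_contra hno
  refine hbad fun t _ => ?_
  have hxY : (fun i => X i ω) = fun i => Y i ω := funext fun i => (hω i).symm
  rw [hxY]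
  refine mem_confidence_of_accepted hδ (fun i => hY i ω) hμ (fun s hs => ?_) t
  refine mem_accepted_of_mixtureWealth_le hδ.1 hs (fun i => hY i ω) hμ ?_
  by_contra hlt
  exact hno ⟨s, not_le.1 hlt⟩

/-! ### The Lambert function and `U` -/

theorem half_log_le {u : ℝ} (hu : 0 < u) : 1 / 2 * Real.log u ≤ u / 2 := by
  linarith [Real.log_le_sub_one_of_pos hu]

theorem exists_sub_half_log_eq {k : ℝ} (hk : 1 ≤ k) :
    ∃ u, 1 ≤ u ∧ u ≤ 2 * k ∧ u - 1 / 2 * Real.log u = k := by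
  have hc : ContinuousOn (fun u : ℝ => u - 1 / 2 * Real.log u) (Set.Icc 1 (2 * k)) := by
    refine continuousOn_id.sub (continuousOn_const.mul (Real.continuousOn_log.mono ?_))
    intro u hu
    have := hu.1
    simp only [Set.mem_compl_iff, Set.mem_singleton_iff]
    linarith
  have := intermediate_value_Icc (by linarith) hc
  obtain ⟨u, hu, h⟩ := this (show k ∈ _ from ⟨by simpa using hk, by
    linarith [half_log_le (u := 2 * k) (by linarith)]⟩)
  exact ⟨u, hu.1, hu.2, h⟩

theorem log_sub_log_lt {u v : ℝ} (hu : 1 ≤ u) (huv : u < v) : Real.log v - Real.log u < v - u := by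
  have hu0 : 0 < u := by linarith
  rw [← Real.log_div (by linarith) hu0.ne']
  have h1 := Real.log_lt_sub_one_of_pos (x := v / u) (div_pos (by linarith) hu0)
    (by rw [ne_eq, div_eq_one_iff_eq hu0.ne']; exact huv.ne')
  refine h1.trans_le ?_
  rw [div_sub_one hu0.ne', div_le_iff₀ hu0]
  nlinarith

theorem mul_exp_neg_injOn {u v : ℝ} (hu : 1 ≤ u) (hv : 1 ≤ v)
    (h : u * Real.exp (-u) = v * Real.exp (-v)) : u = v := by
  have h1 := congrArg Real.log h
  rw [Real.log_mul (by linarith) (Real.exp_ne_zero _),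
    Real.log_mul (by linarith) (Real.exp_ne_zero _), Real.log_exp, Real.log_exp] at h1
  rcases lt_trichotomy u v with h2 | h2 | h2
  · linarith [log_sub_log_lt hu h2]
  · exact h2
  · linarith [log_sub_log_lt hv h2]

theorem lambertWm1_eq {u : ℝ} (hu : 1 ≤ u) : lambertWm1 (-u * Real.exp (-u)) = -u := by
  have : {w : ℝ | w ≤ -1 ∧ w * Real.exp w = -u * Real.exp (-u)} = {-u} := by
    ext w
    simp only [Set.mem_ofPred_eq, Set.mem_singleton_iff]
    constructor
    · rintro ⟨h1, h2⟩
      have := mul_exp_neg_injOn (u := -w) (v := u) (by linarith) hu (by rw [neg_neg]; linarith)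
      linarith
    · rintro rfl
      exact ⟨by linarith, rfl⟩
  rw [lambertWm1, this, csInf_singleton]

/-- The argument `(20 / (3δ)) h(1 / (2 + √(V_t / 2)))` in the definition of `U`. -/
def Karg (δ : ℝ) (x : ℕ → ℝ) (t : ℕ) : ℝ := 20 / (3 * δ) * h (1 / (2 + √(VHat x t / 2)))

section Lambert

variable {δ : ℝ} {x : ℕ → ℝ} {t : ℕ}

theorem one_div_two_add_sqrt_mem (y : ℝ) : 0 < 1 / (2 + √y) ∧ 1 / (2 + √y) ≤ 1 := by
  have := Real.sqrt_nonneg y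
  exact ⟨by positivity, by rw [div_le_one (by positivity)]; linarith⟩

theorem exp_one_le_Karg (hδ : δ ∈ Set.Ioo (0 : ℝ) 1) : Real.exp 1 ≤ Karg δ x t := by
  have h1 := one_div_two_add_sqrt_mem (VHat x t / 2)
  have h2 := four_le_h h1.1 h1.2
  have h3 : (20 / 3 : ℝ) ≤ 20 / (3 * δ) :=
    div_le_div_of_nonneg_left (by norm_num) (by linarith [hδ.1]) (by linarith [hδ.2])
  have h4 := Real.exp_one_lt_d9
  unfold Karg
  nlinarith

theorem Karg_pos (hδ : δ ∈ Set.Ioo (0 : ℝ) 1) : 0 < Karg δ x t :=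
  (Real.exp_pos 1).trans_le (exp_one_le_Karg hδ)

theorem U_spec (hδ : δ ∈ Set.Ioo (0 : ℝ) 1) : 1 ≤ U δ x t ∧
    U δ x t ≤ 2 * Real.log (Karg δ x t) ∧
    U δ x t = Real.log (Karg δ x t) + 1 / 2 * Real.log (U δ x t) := by
  have hK := Karg_pos (x := x) (t := t) hδ
  have hlog : 1 ≤ Real.log (Karg δ x t) := (Real.le_log_iff_exp_le hK).2 (exp_one_le_Karg hδ)
  obtain ⟨u, hu1, hu2, hu⟩ := exists_sub_half_log_eq hlog
  have hu0 : 0 < u := by linarith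
  -- The equation `u - (1/2) ln u = ln K` is `e^(2u) = u K²`, which is the Lambert equation for `w =
  -- -2u`.
  have harg : -2 / Karg δ x t ^ 2 = -(2 * u) * Real.exp (-(2 * u)) := by
    have h1 : Real.exp (-(2 * u)) = (u * Karg δ x t ^ 2)⁻¹ := by
      rw [Real.exp_neg]
      congr 1
      have : 2 * u = Real.log u + 2 * Real.log (Karg δ x t) := by linarith
      rw [this, Real.exp_add, Real.exp_log hu0, two_mul, Real.exp_add, Real.exp_log hK, sq]
    rw [h1]
    field_simp
  have : U δ x t = u := by
    show -(1 / 2) * lambertWm1 (-2 / Karg δ x t ^ 2) = u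
    rw [harg, lambertWm1_eq (by linarith)]
    ring
  rw [this]
  exact ⟨hu1, hu2, by linarith⟩

/-- If `L` exceeded `U`, subtracting `U = ln K + (1/2) ln U` from `L ≤ ln K + (1/2) ln L` would
contradict `ln L - ln U < L - U`, valid since `U ≥ 1`. -/
theorem le_U_of_exp_le (hδ : δ ∈ Set.Ioo (0 : ℝ) 1) {L : ℝ} (hL0 : 0 < L)
    (hL : Real.exp L ≤ Karg δ x t * √L) : L ≤ U δ x t := by
  obtain ⟨h1, -, h2⟩ := U_spec (x := x) (t := t) hδ
  by_contra! hlt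
  have h3 := log_sub_log_lt h1 hlt
  have h4 := Real.log_le_log (Real.exp_pos L) hL
  rw [Real.log_exp, Real.log_mul (Karg_pos hδ).ne' (Real.sqrt_pos.2 hL0).ne', Real.log_sqrt hL0.le]
    at h4
  linarith

end Lambert

/-! ### Lower bounds on the best wealth -/

/-- The difference of the two sides vanishes at `u = 0` and has a nonnegative derivative in `u`.
Summed over coins, the bound involves only their sum and their sum of squares. -/
theorem log_one_add_mul_ge {y u : ℝ} (hy : |y| ≤ 1) (hu0 : 0 ≤ u) (hu1 : u < 1) :
    u * y + (Real.log (1 - u) + u) * y ^ 2 ≤ Real.log (1 + u * y) := by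
  have hy1 := (abs_le.1 hy).1
  have hd : ∀ z ∈ Set.Ico (0 : ℝ) 1, HasDerivAt
      (fun z => Real.log (1 + z * y) - (z * y + (Real.log (1 - z) + z) * y ^ 2))
      (y / (1 + z * y) - (y + (-1 / (1 - z) + 1) * y ^ 2)) z := fun z hz => by
    have h1 : (1 + z * y) ≠ 0 := by nlinarith [hz.1, hz.2]
    have h2 : (1 - z) ≠ 0 := by linarith [hz.2]
    have e1 := (((hasDerivAt_id z).mul_const y).const_add 1).log h1
    have e2 := ((hasDerivAt_id z).const_sub 1).log h2
    have e3 := e1.sub (((hasDerivAt_id z).mul_const y).add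
      ((e2.add (hasDerivAt_id z)).mul_const (y ^ 2)))
    refine e3.congr_deriv ?_
    simp
  have := monotoneOn_of_deriv_nonneg (convex_Ico 0 1)
    (fun z hz => (hd z hz).continuousAt.continuousWithinAt)
    (fun z hz => (hd z (interior_subset hz)).differentiableAt.differentiableWithinAt)
    (fun z hz => by
      have hz' := interior_subset hz
      rw [(hd z hz').deriv]
      have h1 : 0 < 1 + z * y := by nlinarith [hz'.1, hz'.2]
      have h2 : 0 < 1 - z := by linarith [hz'.2]
      have : y / (1 + z * y) - (y + (-1 / (1 - z) + 1) * y ^ 2)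
          = y ^ 2 * z * (z * (1 + y)) / ((1 - z) * (1 + z * y)) := by
        have h3 : 1 + y * z ≠ 0 := by rw [mul_comm y z]; exact h1.ne'
        field_simp; ring
      rw [this]
      have := hz'.1
      have : 0 ≤ 1 + y := by linarith
      positivity)
  have := this ⟨le_rfl, one_pos⟩ ⟨hu0, hu1⟩ hu0
  simp at this
  linarith

theorem pade_le_sub_log {z : ℝ} (hz : 0 ≤ z) :
    3 * z ^ 2 / (6 + 4 * z) ≤ z - Real.log (1 + z) := by
  have hd : ∀ z ∈ Set.Ici (0 : ℝ), HasDerivAt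
      (fun z => z - Real.log (1 + z) - 3 * z ^ 2 / (6 + 4 * z))
      (1 - 1 / (1 + z) - (3 * (2 * z) * (6 + 4 * z) - 3 * z ^ 2 * 4) / (6 + 4 * z) ^ 2) z :=
    fun z hz => by
    have hz := Set.mem_Ici.1 hz
    have h1 : 1 + z ≠ 0 := by linarith
    have h2 : 6 + 4 * z ≠ 0 := by linarith
    have e1 := ((hasDerivAt_id z).const_add 1).log h1
    have e2 := (((hasDerivAt_id z).pow 2).const_mul 3).div
      (((hasDerivAt_id z).const_mul 4).const_add 6) h2
    refine (((hasDerivAt_id z).sub e1).sub e2).congr_deriv ?_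
    simp
  have := monotoneOn_of_deriv_nonneg (convex_Ici 0)
    (fun z hz => (hd z hz).continuousAt.continuousWithinAt)
    (fun z hz => (hd z (interior_subset hz)).differentiableAt.differentiableWithinAt)
    (fun z hz => by
      have hz' := Set.mem_Ici.1 (interior_subset hz)
      rw [(hd z hz').deriv]
      have : 1 - 1 / (1 + z) - (3 * (2 * z) * (6 + 4 * z) - 3 * z ^ 2 * 4) / (6 + 4 * z) ^ 2
          = 4 * z ^ 3 / ((1 + z) * (6 + 4 * z) ^ 2) := by
        field_simp; ring
      rw [this]
      positivity)
  have := this (Set.mem_Ici.2 le_rfl) (Set.mem_Ici.2 hz) hz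
  simp at this
  linarith

section Coins

variable {a : ℕ → ℝ} {t : ℕ}

/-- Summing `log_one_add_mul_ge` leaves `u S + (ln (1 - u) + u) V'`, which is maximal at `u = S / (S
+ V')` with value `V' (z - ln (1 + z))` for `z = S / V'`. The Padé bound turns this into the
Bernstein form. -/
theorem exists_log_prod_ge (ha : ∀ i < t, |a i| ≤ 1) {S V' : ℝ}
    (hS : ∑ i ∈ Finset.range t, a i = S) (hV : ∑ i ∈ Finset.range t, a i ^ 2 = V')
    (hS0 : 0 < S) (hV0 : 0 < V') :
    ∃ u ∈ Set.Icc (0 : ℝ) 1, 0 < ∏ i ∈ Finset.range t, (1 + u * a i) ∧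
      S ^ 2 / (2 * (V' + 2 / 3 * S)) ≤ Real.log (∏ i ∈ Finset.range t, (1 + u * a i)) := by
  have hu0 : 0 < S / (S + V') := by positivity
  have hu1 : S / (S + V') < 1 := by rw [div_lt_one (by positivity)]; linarith
  have hpos : ∀ i ∈ Finset.range t, 0 < 1 + S / (S + V') * a i := fun i hi => by
    have := (abs_le.1 (ha i (Finset.mem_range.1 hi))).1
    nlinarith
  refine ⟨S / (S + V'), ⟨hu0.le, hu1.le⟩, Finset.prod_pos hpos, ?_⟩
  rw [Real.log_prod (fun i hi => (hpos i hi).ne')]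
  have h1 : ∑ i ∈ Finset.range t, (S / (S + V') * a i
      + (Real.log (1 - S / (S + V')) + S / (S + V')) * a i ^ 2)
      ≤ ∑ i ∈ Finset.range t, Real.log (1 + S / (S + V') * a i) :=
    Finset.sum_le_sum fun i hi =>
      log_one_add_mul_ge (ha i (Finset.mem_range.1 hi)) hu0.le hu1
  rw [Finset.sum_add_distrib, ← Finset.mul_sum, ← Finset.mul_sum, hS, hV] at h1
  refine le_trans ?_ h1
  have h2 : 1 - S / (S + V') = (1 + S / V')⁻¹ := by field_simp; ring
  rw [h2, Real.log_inv]
  have h3 := mul_le_mul_of_nonneg_left (pade_le_sub_log (z := S / V') (by positivity)) hV0.le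
  have h4 : S ^ 2 / (2 * (V' + 2 / 3 * S))
      = V' * (3 * (S / V') ^ 2 / (6 + 4 * (S / V'))) := by
    field_simp; ring
  have h5 : S / (S + V') * S + (-Real.log (1 + S / V') + S / (S + V')) * V'
      = V' * (S / V' - Real.log (1 + S / V')) := by
    field_simp; ring
  rw [h4, h5]
  exact h3

theorem sum_eq_deriv_add {b : ℝ} (hpos : ∀ i < t, 0 < 1 + b * a i) :
    ∑ i ∈ Finset.range t, a i = ∑ i ∈ Finset.range t, a i / (1 + b * a i)
      + b * ∑ i ∈ Finset.range t, a i ^ 2 / (1 + b * a i) := by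
  rw [Finset.mul_sum, ← Finset.sum_add_distrib]
  refine Finset.sum_congr rfl fun i hi => ?_
  have := (hpos i (Finset.mem_range.1 hi)).ne'
  rw [mul_div_assoc', ← add_div, eq_div_iff this]
  ring

theorem sum_le_of_deriv_eq_zero (ha : ∀ i < t, |a i| ≤ 1) {b : ℝ} (hb0 : 0 < b) (hb1 : b < 1)
    (h0 : ∑ i ∈ Finset.range t, a i / (1 + b * a i) = 0) :
    (∑ i ∈ Finset.range t, a i) * (1 - b) ≤ b * ∑ i ∈ Finset.range t, a i ^ 2 := by
  have hpos : ∀ i < t, 1 - b ≤ 1 + b * a i := fun i hi => by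
    have := (abs_le.1 (ha i hi)).1
    nlinarith
  have hb : 0 < 1 - b := by linarith
  rw [sum_eq_deriv_add (b := b) (fun i hi => hb.trans_le (hpos i hi)), h0, zero_add, mul_assoc]
  refine mul_le_mul_of_nonneg_left ?_ hb0.le
  rw [Finset.sum_mul]
  refine Finset.sum_le_sum fun i hi => ?_
  have h1 := hpos i (Finset.mem_range.1 hi)
  have : 0 < 1 + b * a i := hb.trans_le h1
  rw [div_mul_eq_mul_div, div_le_iff₀ this]
  gcongr

theorem sum_sq_le_of_deriv_nonneg (ha : ∀ i < t, |a i| ≤ 1) {b : ℝ} (hb0 : 0 < b) (hb1 : b ≤ 1)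
    (hpos : ∀ i < t, 0 < 1 + b * a i)
    (h0 : 0 ≤ ∑ i ∈ Finset.range t, a i / (1 + b * a i)) :
    b * ∑ i ∈ Finset.range t, a i ^ 2 ≤ 2 * ∑ i ∈ Finset.range t, a i := by
  have h1 : ∑ i ∈ Finset.range t, a i ^ 2 ≤ 2 * ∑ i ∈ Finset.range t, a i ^ 2 / (1 + b * a i) := by
    rw [Finset.mul_sum]
    refine Finset.sum_le_sum fun i hi => ?_
    have h2 := hpos i (Finset.mem_range.1 hi)
    have h3 := (abs_le.1 (ha i (Finset.mem_range.1 hi))).2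
    rw [mul_div_assoc', le_div_iff₀ h2, mul_comm 2]
    gcongr
    nlinarith
  rw [sum_eq_deriv_add hpos]
  nlinarith

theorem log_one_add_sub_ge {y b : ℝ} (hy : |y| ≤ 1) (hb0 : 0 ≤ b) (hb1 : b < 1) :
    b ^ 2 * y ^ 2 / (2 * (1 + b) ^ 2) ≤ Real.log (1 + b * y) - b * y / (1 + b * y) := by
  have hy1 := (abs_le.1 hy).1
  have hy2 := (abs_le.1 hy).2
  have hd : ∀ z ∈ Set.Icc (0 : ℝ) b, HasDerivAt
      (fun z => Real.log (1 + z * y) - z * y / (1 + z * y) - z ^ 2 * y ^ 2 / (2 * (1 + b) ^ 2))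
      (y / (1 + z * y) - (y * (1 + z * y) - z * y * y) / (1 + z * y) ^ 2
        - 2 * z * y ^ 2 / (2 * (1 + b) ^ 2)) z := fun z hz => by
    have h1 : (1 + z * y) ≠ 0 := by nlinarith [hz.1, hz.2]
    have e0 := (hasDerivAt_id z).mul_const y
    have e1 := (e0.const_add 1).log h1
    have e2 := e0.div (e0.const_add 1) h1
    have e3 := (((hasDerivAt_id z).pow 2).mul_const (y ^ 2)).div_const (2 * (1 + b) ^ 2)
    refine ((e1.sub e2).sub e3).congr_deriv ?_
    simp
  have := monotoneOn_of_deriv_nonneg (convex_Icc 0 b)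
    (fun z hz => (hd z hz).continuousAt.continuousWithinAt)
    (fun z hz => (hd z (interior_subset hz)).differentiableAt.differentiableWithinAt)
    (fun z hz => by
      have hz' := interior_subset hz
      rw [(hd z hz').deriv]
      have h1 : 0 < 1 + z * y := by nlinarith [hz'.1, hz'.2]
      have h2 : 1 + z * y ≤ 1 + b := by nlinarith [hz'.1, hz'.2]
      have : y / (1 + z * y) - (y * (1 + z * y) - z * y * y) / (1 + z * y) ^ 2
          - 2 * z * y ^ 2 / (2 * (1 + b) ^ 2)
          = z * y ^ 2 * (1 / (1 + z * y) ^ 2 - 1 / (1 + b) ^ 2) := by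
        field_simp; ring
      rw [this]
      have h3 : 0 ≤ 1 / (1 + z * y) ^ 2 - 1 / (1 + b) ^ 2 := by
        rw [sub_nonneg]
        gcongr
      have := hz'.1
      positivity)
  have := this ⟨le_rfl, hb0⟩ ⟨hb0, le_rfl⟩ hb0
  simp at this
  linarith

/-- The terms `b a / (1 + b a)` sum to zero at a stationary point, so they can be subtracted freely;
what remains of each logarithm is quadratic in the coin. -/
theorem sq_mul_sum_sq_le_log_prod (ha : ∀ i < t, |a i| ≤ 1) {b : ℝ} (hb0 : 0 < b) (hb1 : b < 1)
    (h0 : ∑ i ∈ Finset.range t, a i / (1 + b * a i) = 0) :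
    b ^ 2 * (∑ i ∈ Finset.range t, a i ^ 2) / (2 * (1 + b) ^ 2)
      ≤ Real.log (∏ i ∈ Finset.range t, (1 + b * a i)) := by
  have hpos : ∀ i ∈ Finset.range t, 0 < 1 + b * a i := fun i hi => by
    have := (abs_le.1 (ha i (Finset.mem_range.1 hi))).1
    nlinarith
  rw [Real.log_prod (fun i hi => (hpos i hi).ne')]
  have h1 := Finset.sum_le_sum fun i (hi : i ∈ Finset.range t) =>
    log_one_add_sub_ge (ha i (Finset.mem_range.1 hi)) hb0.le hb1
  rw [Finset.sum_sub_distrib] at h1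
  have h2 : ∑ i ∈ Finset.range t, b * a i / (1 + b * a i) = 0 := by
    simp only [mul_div_assoc, ← Finset.mul_sum, h0, mul_zero]
  rw [h2, sub_zero, ← Finset.sum_div, ← Finset.mul_sum] at h1
  exact h1

end Coins

/-! ### Width of the confidence sequence -/

section Width

variable {x : ℕ → ℝ} {t : ℕ} {m δ : ℝ}

theorem V_eq (ht : 1 ≤ t) (x : ℕ → ℝ) (m : ℝ) :
    V x t m = VHat x t + t * (muHat x t - m) ^ 2 := by
  have h1 := sum_sub_eq ht x (muHat x t)
  unfold VHat V
  have h2 : ∀ i, (x i - m) ^ 2 = (x i - muHat x t) ^ 2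
      + 2 * (muHat x t - m) * (x i - muHat x t) + (muHat x t - m) ^ 2 := fun i => by ring
  simp only [h2, Finset.sum_add_distrib, ← Finset.mul_sum, h1]
  simp

theorem VHat_nonneg : 0 ≤ VHat x t := V_nonneg

theorem log_wealthStar_ge (ht : 1 ≤ t) (hx : ∀ i, x i ∈ Set.Icc (0 : ℝ) 1)
    (hm : m ∈ Set.Icc (0 : ℝ) 1) (hne : muHat x t ≠ m) :
    (t * |muHat x t - m|) ^ 2 / (2 * (V x t m + 2 / 3 * (t * |muHat x t - m|)))
      ≤ Real.log (wealthStar x t m) := by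
  have ht0 : (0 : ℝ) < t := by positivity
  have hne' : muHat x t - m ≠ 0 := sub_ne_zero.2 hne
  have hs := sign_mul_self hne'
  have hS : ∑ i ∈ Finset.range t, Real.sign (muHat x t - m) * (x i - m)
      = t * |muHat x t - m| := by
    rw [← Finset.mul_sum, sum_sub_eq ht, mul_left_comm]
    congr 1
    rcases lt_or_gt_of_ne hne' with h | h
    · rw [Real.sign_of_neg h, abs_of_neg h]; ring
    · rw [Real.sign_of_pos h, abs_of_pos h, one_mul]
  have hV : ∑ i ∈ Finset.range t, (Real.sign (muHat x t - m) * (x i - m)) ^ 2 = V x t m := by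
    unfold V
    refine Finset.sum_congr rfl fun i _ => ?_
    rw [mul_pow, sq (Real.sign _), hs, one_mul]
  have habs : |Real.sign (muHat x t - m)| = 1 := by
    rcases Real.sign_apply_eq_of_ne_zero _ hne' with h | h <;> simp [h]
  obtain ⟨u, hu, hpos, hle⟩ := exists_log_prod_ge
    (fun i _ => by rw [abs_mul, habs, one_mul]; exact abs_sub_le_one hx hm i) hS hV
    (mul_pos ht0 (abs_pos.2 hne'))
    (by rw [V_eq ht]; have := VHat_nonneg (x := x) (t := t); positivity)
  refine hle.trans (Real.log_le_log hpos ?_)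
  have : ∏ i ∈ Finset.range t, (1 + u * (Real.sign (muHat x t - m) * (x i - m)))
      = wealth x t m (Real.sign (muHat x t - m) * u) := by
    unfold wealth
    refine Finset.prod_congr rfl fun i _ => ?_
    ring
  rw [this]
  refine wealth_le_wealthStar (abs_le.1 ?_)
  rw [abs_mul, habs, one_mul, abs_of_nonneg hu.1]
  exact hu.2

theorem log_wealthStar_pos (ht : 1 ≤ t) (hx : ∀ i, x i ∈ Set.Icc (0 : ℝ) 1)
    (hm : m ∈ Set.Icc (0 : ℝ) 1) (hne : muHat x t ≠ m) : 0 < Real.log (wealthStar x t m) := by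
  have ht0 : (0 : ℝ) < t := by positivity
  have := abs_pos.2 (sub_ne_zero.2 hne)
  have := V_nonneg (x := x) (t := t) (m := m)
  exact lt_of_lt_of_le (by positivity) (log_wealthStar_ge ht hx hm hne)

/-- Since `0 < ln W* ≤ β* t (muHat - m)`, the best bet points towards the empirical mean. -/
theorem betaStar_mul_pos (ht : 1 ≤ t) (hx : ∀ i, x i ∈ Set.Icc (0 : ℝ) 1)
    (hm : m ∈ Set.Icc (0 : ℝ) 1) (hne : muHat x t ≠ m) :
    0 < betaStar x t m * (muHat x t - m) := by
  have h1 := log_wealthStar_pos ht hx hm hne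
  have h2 := wealth_le_exp (t := t) hx hm (abs_betaStar_le_one (x := x) (t := t) (m := m))
  have h3 := Real.log_le_log wealthStar_pos h2
  rw [Real.log_exp, sum_sub_eq ht, mul_left_comm] at h3
  have ht0 : (0 : ℝ) < t := by positivity
  exact pos_of_mul_pos_right (h1.trans_le h3) ht0.le

theorem sum_coin (ht : 1 ≤ t) (hx : ∀ i, x i ∈ Set.Icc (0 : ℝ) 1)
    (hm : m ∈ Set.Icc (0 : ℝ) 1) (hne : muHat x t ≠ m) :
    ∑ i ∈ Finset.range t, coin x t m i = t * |muHat x t - m| := by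
  unfold coin
  rw [← Finset.mul_sum, sum_sub_eq ht, mul_left_comm]
  congr 1
  rcases pos_and_pos_or_neg_and_neg_of_mul_pos (betaStar_mul_pos ht hx hm hne) with h | h
  · rw [Real.sign_of_pos h.1, abs_of_pos h.2, one_mul]
  · rw [Real.sign_of_neg h.1, abs_of_neg h.2]; ring

/-- With `S = t |muHat - m|` and `b = |β*| < 1`, stationarity gives `S (1 - b) ≤ b (VHat + S²/t)`.
Here `VHat ≤ S √(VHat/2)` by `hS` and `S²/t ≤ S`; dividing by `S` gives the claim. This bounds `h
|β*|` by the value of `h` appearing in `U`. -/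
theorem one_div_le_abs_betaStar (ht : 1 ≤ t) (hx : ∀ i, x i ∈ Set.Icc (0 : ℝ) 1)
    (hm : m ∈ Set.Icc (0 : ℝ) 1) (hne : muHat x t ≠ m)
    (hS : √(2 * VHat x t) ≤ t * |muHat x t - m|) :
    1 / (2 + √(VHat x t / 2)) ≤ |betaStar x t m| := by
  have h0 : betaStar x t m ≠ 0 := left_ne_zero_of_mul (betaStar_mul_pos ht hx hm hne).ne'
  have hb := abs_pos.2 h0
  rcases abs_betaStar_le_one.lt_or_eq (a := |betaStar x t m|) with h1 | h1
  swap
  · rw [h1]; exact (one_div_two_add_sqrt_mem _).2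
  have ha : ∀ i < t, |coin x t m i| ≤ 1 := fun i _ => abs_coin_le_one (t := t) hx hm i
  have h2 := sum_le_of_deriv_eq_zero ha hb h1
    (deriv_eq_zero_of_isMaxOn ha hb h1 (isMaxOn_prod_coin h0))
  rw [sum_coin ht hx hm hne, ← V_eq_coin h0, V_eq ht] at h2
  have ht0 : (0 : ℝ) < t := by positivity
  have hd0 := abs_pos.2 (sub_ne_zero.2 hne)
  have hd1 : |muHat x t - m| ≤ 1 := by
    have := muHat_mem hx t
    exact abs_le.2 ⟨by linarith [this.1, hm.2], by linarith [this.2, hm.1]⟩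
  have hV := VHat_nonneg (x := x) (t := t)
  have hVS : VHat x t ≤ t * |muHat x t - m| * √(VHat x t / 2) := by
    have h3 : √(2 * VHat x t) * √(VHat x t / 2) = VHat x t := by
      rw [← Real.sqrt_mul (by positivity), show 2 * VHat x t * (VHat x t / 2) = VHat x t ^ 2 by ring,
        Real.sqrt_sq hV]
    calc VHat x t = √(2 * VHat x t) * √(VHat x t / 2) := h3.symm
      _ ≤ _ := by gcongr
  have hr := Real.sqrt_nonneg (VHat x t / 2)
  rw [div_le_iff₀ (by positivity)]
  rw [← sq_abs (muHat x t - m)] at h2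
  have h4 : t * |muHat x t - m| * 1 ≤ t * |muHat x t - m|
      * (|betaStar x t m| * (2 + √(VHat x t / 2))) := by
    have h5 : t * |muHat x t - m| ^ 2 ≤ t * |muHat x t - m| := by
      nlinarith [mul_nonneg ht0.le hd0.le]
    nlinarith
  exact le_of_mul_le_mul_left h4 (by positivity)

theorem h_le_fifteen {y : ℝ} (hy : 2 / 5 ≤ y) (hy1 : y ≤ 1) : h y ≤ 15 := by
  refine (h_anti (by norm_num) hy hy1).trans ?_
  have he := Real.exp_one_lt_d9
  have he' := Real.exp_one_gt_d9
  have h1 : Real.log (c / (2 / 5)) ≤ 4 := by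
    rw [Real.log_le_iff_le_exp (div_pos c_pos (by norm_num))]
    have : Real.exp 4 = Real.exp 1 ^ 4 := by rw [← Real.exp_nat_mul]; norm_num
    rw [this]
    have : (2.7 : ℝ) ^ 4 ≤ Real.exp 1 ^ 4 := by gcongr; linarith
    unfold c
    rw [div_le_iff₀ (by norm_num)]
    linarith
  have h0 := le_log_div (x := 2 / 5) (by norm_num) (by norm_num)
  have h0' := le_log_log_div (x := 2 / 5) (by norm_num) (by norm_num)
  have h2 : Real.log (Real.log (c / (2 / 5))) ≤ 1.4 := by
    refine (Real.log_le_log (by linarith) h1).trans ?_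
    rw [show (4 : ℝ) = 2 ^ 2 by norm_num, Real.log_pow]
    have := Real.log_two_lt_d9
    push_cast
    linarith
  have h3 := le_log_log_c
  have h4 : 2 / Real.log (Real.log c) ≤ 1.9 := by
    rw [div_le_iff₀ (by linarith)]; linarith
  unfold h
  have : 0 < Real.log (Real.log c) := by linarith
  have : 0 ≤ Real.log (c / (2 / 5)) := by linarith
  have : 0 ≤ Real.log (Real.log (c / (2 / 5))) := by linarith
  calc _ ≤ (1.9 : ℝ) * 4 * 1.4 ^ 2 := by gcongr
    _ ≤ 15 := by norm_num

theorem mul_le_exp_half {L : ℝ} (hL : 17 ≤ L) : 24 * L ≤ Real.exp (L / 2) := by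
  have he' := Real.exp_one_gt_d9
  have h1 : Real.exp (L / 2) = Real.exp 1 ^ 8 * Real.exp (L / 2 - 8) := by
    rw [← Real.exp_nat_mul, ← Real.exp_add]; congr 1; push_cast; ring
  have h2 : (2.7 : ℝ) ^ 8 ≤ Real.exp 1 ^ 8 := by gcongr; linarith
  have h3 := Real.add_one_le_exp (L / 2 - 8)
  rw [h1]
  calc 24 * L ≤ 2.7 ^ 8 * (L / 2 - 8 + 1) := by norm_num; linarith
    _ ≤ _ := by gcongr; linarith

theorem log_wealthStar_le_of_large_bet (hδ : δ ∈ Set.Ioo (0 : ℝ) 1) (ht : 1 ≤ t)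
    (hx : ∀ i, x i ∈ Set.Icc (0 : ℝ) 1) (hm : m ∈ Set.Icc (0 : ℝ) 1) (hne : muHat x t ≠ m)
    (hacc : m ∈ accepted δ x t) (hS : √(2 * VHat x t) ≤ t * |muHat x t - m|)
    (hL1 : 1 ≤ Real.log (wealthStar x t m)) (hb : 9 / 20 ≤ |betaStar x t m|) :
    Real.log (wealthStar x t m) ≤ U δ x t ∨
      t * |muHat x t - m| ≤ 24 * Real.log (7 / (6 * δ)) := by
  have h0 : betaStar x t m ≠ 0 := left_ne_zero_of_mul (betaStar_mul_pos ht hx hm hne).ne'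
  have hb0 := abs_pos.2 h0
  have hb1 := abs_betaStar_le_one (x := x) (t := t) (m := m)
  have hW := wealthStar_pos (x := x) (t := t) (m := m)
  have hδ0 := hδ.1
  have hSb := one_div_le_abs_betaStar ht hx hm hne hS
  have hh := h_pos hb0 hb1
  have hhK := h_anti (one_div_two_add_sqrt_mem (VHat x t / 2)).1 hSb hb1
  have hlo := log_wealthStar_ge ht hx hm hne
  obtain ⟨L, hL⟩ : ∃ L, L = Real.log (wealthStar x t m) := ⟨_, rfl⟩
  rw [← hL] at hL1 hlo ⊢
  have hWL : wealthStar x t m = Real.exp L := by rw [hL, Real.exp_log hW]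
  have hL0 : 0 < L := by linarith
  have he : 8 / 3 ≤ Real.exp L := by
    have := Real.exp_one_gt_d9
    have := Real.exp_le_exp.2 hL1
    linarith
  -- The power term of `R` gives `(e^L - 1) / (L h) ≤ 1/δ`, since `|β*| F(β*) = 1 / h`; and `e^L ≥
  -- 8/3` gives `e^L - 1 ≥ (5/8) e^L`.
  have hbound : Real.exp L ≤ 8 / 5 * L * h |betaStar x t m| / δ := by
    have h1 := (mem_accepted_iff hδ0 h0).1 hacc
    have hF := F_pos h0 hb1
    have h2 : wealthStar x t m * (logRatio (wealthStar x t m) * |betaStar x t m|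
        * F (betaStar x t m)) ≤ 1 / δ := by
      refine le_trans ?_ h1
      unfold invR
      gcongr
      exact le_max_left _ _
    have h3 : wealthStar x t m * (logRatio (wealthStar x t m) * |betaStar x t m|
        * F (betaStar x t m)) = (Real.exp L - 1) / (L * h |betaStar x t m|) := by
      rw [logRatio, if_neg (by rw [hWL]; linarith), ← hL, hWL, F]
      field_simp
    rw [h3, div_le_div_iff₀ (by positivity) hδ0] at h2
    rw [le_div_iff₀ hδ0]
    nlinarith
  -- The threshold is where `(8/5) √L` reaches the factor `20/3` in `U`.
  by_cases hcase : √L ≤ 25 / 6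
  · left
    refine le_U_of_exp_le hδ hL0 (hbound.trans ?_)
    unfold Karg
    have hsq := Real.mul_self_sqrt hL0.le
    have hs0 := Real.sqrt_nonneg L
    calc 8 / 5 * L * h |betaStar x t m| / δ
        = 8 / 5 * (√L * √L) * h |betaStar x t m| / δ := by rw [hsq]
      _ ≤ 8 / 5 * (25 / 6 * √L) * h (1 / (2 + √(VHat x t / 2))) / δ := by gcongr
      _ = _ := by field_simp; ring
  · right
    have hL17 : 17 ≤ L := by
      push Not at hcase
      have := Real.sq_sqrt hL0.le
      nlinarith
    have h1 : Real.exp L ≤ Real.exp (L / 2) / δ := by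
      refine hbound.trans ?_
      gcongr
      refine le_trans ?_ (mul_le_exp_half hL17)
      nlinarith [h_le_fifteen (by linarith : (2 / 5 : ℝ) ≤ |betaStar x t m|) hb1]
    have h2 : L ≤ 2 * Real.log (1 / δ) := by
      have h3 := Real.log_le_log (Real.exp_pos L) h1
      rw [Real.log_div (Real.exp_ne_zero _) hδ0.ne', Real.log_exp, Real.log_exp] at h3
      rw [one_div, Real.log_inv]
      linarith
    have ha : ∀ i < t, |coin x t m i| ≤ 1 := fun i _ => abs_coin_le_one (t := t) hx hm i
    have h3 := sum_sq_le_of_deriv_nonneg ha hb0 hb1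
      (pos_of_one_le_prod ha (by rw [abs_abs]; exact hb1)
        (by rw [prod_coin_abs h0]; exact one_le_wealthStar))
      (deriv_nonneg_of_isMaxOn ha hb0 hb1 (isMaxOn_prod_coin h0))
    rw [sum_coin ht hx hm hne, ← V_eq_coin h0] at h3
    have ht0 : (0 : ℝ) < t := by positivity
    have hS0 : 0 < t * |muHat x t - m| := mul_pos ht0 (abs_pos.2 (sub_ne_zero.2 hne))
    have hV0 := V_nonneg (x := x) (t := t) (m := m)
    have h4 : V x t m ≤ 40 / 9 * (t * |muHat x t - m|) := by nlinarith
    -- From `V(m) ≤ (40/9) S`: `2 (40/9 + 2/3) = 92/9`. With `L ≤ 2 ln (1/δ)` this gives `S ≤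
    -- (184/9) ln (1/δ)`, below the allowed factor 24.
    have h5 : 9 / 92 * (t * |muHat x t - m|) ≤ L := by
      refine le_trans ?_ hlo
      rw [le_div_iff₀ (by positivity)]
      nlinarith
    have h6 : Real.log (1 / δ) ≤ Real.log (7 / (6 * δ)) := by
      refine Real.log_le_log (by positivity) ?_
      rw [div_le_div_iff₀ hδ0 (by positivity)]
      linarith
    linarith

theorem log_wealthStar_le_of_small_bet (hδ : δ ∈ Set.Ioo (0 : ℝ) 1) (ht : 1 ≤ t)
    (hx : ∀ i, x i ∈ Set.Icc (0 : ℝ) 1) (hm : m ∈ Set.Icc (0 : ℝ) 1) (hne : muHat x t ≠ m)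
    (hacc : m ∈ accepted δ x t) (hS : √(2 * VHat x t) ≤ t * |muHat x t - m|)
    (hL1 : 1 ≤ Real.log (wealthStar x t m)) (hb : |betaStar x t m| < 9 / 20) :
    Real.log (wealthStar x t m) ≤ U δ x t := by
  have h0 : betaStar x t m ≠ 0 := left_ne_zero_of_mul (betaStar_mul_pos ht hx hm hne).ne'
  have hb0 := abs_pos.2 h0
  have hb1 : |betaStar x t m| < 1 := by linarith
  have hW := wealthStar_pos (x := x) (t := t) (m := m)
  have hδ0 := hδ.1
  have ht0 : (0 : ℝ) < t := by positivity
  have hSb := one_div_le_abs_betaStar ht hx hm hne hS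
  have hh := h_pos hb0 hb1.le
  have hhK := h_anti (one_div_two_add_sqrt_mem (VHat x t / 2)).1 hSb hb1.le
  have hd := le_d (t := t) ht hx hm
  have hd0 : 0 < d x t m := by linarith
  have hV : 0 < V x t m := by
    rw [V_eq ht]
    have := VHat_nonneg (x := x) (t := t)
    have : 0 < t * (muHat x t - m) ^ 2 := by have := sub_ne_zero.2 hne; positivity
    linarith
  have hsV := Real.sqrt_pos.2 hV
  have hsV2 := Real.sq_sqrt hV.le
  have ha : ∀ i < t, |coin x t m i| ≤ 1 := fun i _ => abs_coin_le_one (t := t) hx hm i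
  have hD := deriv_eq_zero_of_isMaxOn ha hb0 hb1 (isMaxOn_prod_coin h0)
  have hup := prod_exp_le_prod (a := coin x t m) (u := 0) hd0
    (fun i hi => d_le_of_coin hi le_rfl hb0.le) (fun i hi => d_le_of_coin hi hb0.le le_rfl) hD
  have hlo := sq_mul_sum_sq_le_log_prod ha hb0 hb1 hD
  rw [prod_coin_abs h0, ← V_eq_coin h0] at hup hlo
  have hacc' := (mem_accepted_iff hδ0 h0).1 hacc
  obtain ⟨L, hL⟩ : ∃ L, L = Real.log (wealthStar x t m) := ⟨_, rfl⟩
  have hWL : wealthStar x t m = Real.exp L := by rw [hL, Real.exp_log hW]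
  rw [← hL] at hL1 hlo ⊢
  have hL0 : 0 < L := by linarith
  obtain ⟨b, hbdef⟩ : ∃ b, b = |betaStar x t m| := ⟨_, rfl⟩
  have hdt : deltaTilde x t m = d x t m / √(V x t m) := by rw [deltaTilde, if_pos hb1]
  have hup' : L ≤ b ^ 2 * V x t m / (2 * d x t m ^ 2) := by
    simp only [zero_mul, add_zero, Finset.prod_const_one, sub_zero] at hup
    rw [hWL, ← Real.exp_add, Real.exp_le_one_iff, neg_div, ← hbdef] at hup
    linarith
  -- The Gaussian bound at `u = 0`, where the wealth is `1`, gives `L ≤ b² V / (2 d²)`. If `b √V <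
  -- d`, then `L ≤ 1/2`, against `L ≥ 1`. Hence `Delta` is not truncated and the exponent in `R`
  -- equals `-1/2`.
  have hle : deltaTilde x t m ≤ b := by
    by_contra! hlt
    rw [hdt, lt_div_iff₀ hsV] at hlt
    have h1 : b ^ 2 * V x t m ≤ d x t m ^ 2 := by
      rw [← hsV2, ← mul_pow]
      have : 0 ≤ b * √(V x t m) := by rw [hbdef]; positivity
      gcongr
    have : b ^ 2 * V x t m / (2 * d x t m ^ 2) ≤ 1 / 2 := by
      rw [div_le_div_iff₀ (by positivity) (by norm_num)]
      linarith
    linarith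
  have hDelta : Delta x t m = d x t m / √(V x t m) := by
    unfold Delta
    rw [← hbdef, max_eq_left (by linarith), ← hdt]; ring
  have hexp : -(Delta x t m ^ 2 * V x t m) / (2 * d x t m ^ 2) = -(1 / 2) := by
    rw [hDelta, div_pow, hsV2]
    field_simp
  rw [← hbdef] at hb hb0 hb1 hd hhK hh hlo
  have hbound : Real.exp L ≤ Real.exp (1 / 2) * (b * √(V x t m)) * h b / d x t m / δ := by
    have hF := F_pos h0 (hbdef ▸ hb1.le)
    have h2 : wealthStar x t m * (Real.exp (-(1 / 2)) * (d x t m / √(V x t m))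
        * F (betaStar x t m)) ≤ 1 / δ := by
      refine le_trans ?_ hacc'
      unfold invR
      gcongr
      rw [hexp, hDelta]
      exact le_max_right _ _
    rw [hWL, F, ← hbdef, Real.exp_neg] at h2
    calc Real.exp L = Real.exp L * ((Real.exp (1 / 2))⁻¹ * (d x t m / √(V x t m)) * (1 / (b * h b)))
          * (Real.exp (1 / 2) * (b * √(V x t m)) * h b / d x t m) := by
          have := Real.exp_ne_zero (1 / 2)
          field_simp
      _ ≤ 1 / δ * (Real.exp (1 / 2) * (b * √(V x t m)) * h b / d x t m) := by gcongr
      _ = _ := by ring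
  have hbV : b * √(V x t m) ≤ √2 * (1 + b) * √L := by
    have h1 : b ^ 2 * V x t m ≤ 2 * (1 + b) ^ 2 * L := by
      rw [div_le_iff₀ (by positivity)] at hlo
      linarith
    refine le_of_sq_le_sq ?_ (by positivity)
    rw [mul_pow, hsV2, mul_pow, mul_pow, Real.sq_sqrt (by norm_num), Real.sq_sqrt hL0.le]
    exact h1
  have hnum : Real.exp (1 / 2) * √2 ≤ 2.4 := by
    refine le_of_sq_le_sq ?_ (by norm_num)
    rw [mul_pow, Real.sq_sqrt (by norm_num), ← Real.exp_nat_mul]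
    have := Real.exp_one_lt_d9
    norm_num
    linarith
  -- Since `b < 9/20` and `d ≥ 1 - b`. The product `2.4 * 29/11` stays below the constant `20/3` of
  -- `U`.
  have hratio : (1 + b) / d x t m ≤ 29 / 11 := by
    rw [div_le_div_iff₀ hd0 (by norm_num)]
    linarith
  refine le_U_of_exp_le hδ hL0 (hbound.trans ?_)
  unfold Karg
  calc Real.exp (1 / 2) * (b * √(V x t m)) * h b / d x t m / δ
      ≤ Real.exp (1 / 2) * (√2 * (1 + b) * √L) * h (1 / (2 + √(VHat x t / 2))) / d x t m / δ := by
        gcongr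
    _ = Real.exp (1 / 2) * √2 * ((1 + b) / d x t m)
          * (h (1 / (2 + √(VHat x t / 2))) * √L / δ) := by field_simp
    _ ≤ 2.4 * (29 / 11) * (h (1 / (2 + √(VHat x t / 2))) * √L / δ) := by
        have : 0 < h (1 / (2 + √(VHat x t / 2))) := hh.trans_le hhK
        gcongr
    _ ≤ 20 / 3 * (h (1 / (2 + √(VHat x t / 2))) * √L / δ) := by
        have : 0 < h (1 / (2 + √(VHat x t / 2))) := hh.trans_le hhK
        gcongr
        norm_num
    _ = _ := by field_simp

theorem width_of_accepted (hδ : δ ∈ Set.Ioo (0 : ℝ) 1) (ht : 1 ≤ t)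
    (hx : ∀ i, x i ∈ Set.Icc (0 : ℝ) 1) (hm : m ∈ Set.Icc (0 : ℝ) 1)
    (hU : 2 * U δ x t < t) (hacc : m ∈ accepted δ x t) :
    |muHat x t - m| ≤ widthBound δ x t := by
  obtain ⟨hU1, -, -⟩ := U_spec (x := x) (t := t) hδ
  have ht0 : (0 : ℝ) < t := by positivity
  have hV := VHat_nonneg (x := x) (t := t)
  have hk : 0 < 1 - 2 * U δ x t / t := by
    rw [sub_pos, div_lt_one ht0]; exact hU
  have hk1 : 1 - 2 * U δ x t / t ≤ 1 := by
    have : 0 ≤ 2 * U δ x t / t := by positivity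
    linarith
  obtain ⟨u, hu⟩ : ∃ u, u = U δ x t / (1 - 2 * U δ x t / t) := ⟨_, rfl⟩
  have hu1 : 1 ≤ u := by
    rw [hu, le_div_iff₀ hk]; linarith
  have hlog : 0 < Real.log (7 / (6 * δ)) := by
    refine Real.log_pos ?_
    rw [lt_div_iff₀ (by linarith [hδ.1])]
    linarith [hδ.2]
  have hwb : widthBound δ x t
      = (√(u * (2 * VHat x t)) + 4 / 3 * u + 24 * Real.log (7 / (6 * δ))) / t := by
    unfold widthBound
    rw [← hu, max_eq_left hu1]
    have : 4 / 3 * U δ x t / (t - 2 * U δ x t) = 4 / 3 * u / t := by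
      rw [hu, one_sub_div ht0.ne']
      have : (t : ℝ) - 2 * U δ x t ≠ 0 := by linarith
      field_simp
    rw [this]
    ring
  rw [hwb, le_div_iff₀ ht0]
  by_contra! hlt
  rw [mul_comm |muHat x t - m|] at hlt
  obtain ⟨S, hSdef⟩ : ∃ S, S = t * |muHat x t - m| := ⟨_, rfl⟩
  rw [← hSdef] at hlt
  have hr0 := Real.sqrt_nonneg (u * (2 * VHat x t))
  have hS0 : 0 < S := by linarith
  have hne : muHat x t ≠ m := by
    rintro h
    rw [h, sub_self, abs_zero, mul_zero] at hSdef
    linarith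
  have hSV : √(2 * VHat x t) ≤ t * |muHat x t - m| := by
    rw [← hSdef]
    have : √(2 * VHat x t) ≤ √(u * (2 * VHat x t)) :=
      Real.sqrt_le_sqrt (le_mul_of_one_le_left (by positivity) hu1)
    linarith
  have hlo := log_wealthStar_ge ht hx hm hne
  -- If `S` exceeds the claimed bound then `S² > 2 u VHat + (4/3) u S`. Multiplying by `1 - 2U/t`
  -- moves the part `S²/t` of `V(m)` to the right-hand side and shows that the Bernstein lower bound
  -- exceeds `U`.
  have hmain : U δ x t < Real.log (wealthStar x t m) := by
    refine lt_of_lt_of_le ?_ hlo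
    rw [V_eq ht, ← sq_abs (muHat x t - m), ← hSdef]
    have h1 : t * |muHat x t - m| ^ 2 = S ^ 2 / t := by rw [hSdef]; field_simp
    rw [h1, lt_div_iff₀ (by positivity)]
    have h2 : u * (2 * VHat x t) + 4 / 3 * u * S < S ^ 2 := by
      have := Real.sq_sqrt (show 0 ≤ u * (2 * VHat x t) by positivity)
      nlinarith
    have h3 : U δ x t = u * (1 - 2 * U δ x t / t) := by
      rw [hu, div_mul_cancel₀ _ hk.ne']
    have h4 := mul_lt_mul_of_pos_right h2 hk
    have h5 : (u * (2 * VHat x t) + 4 / 3 * u * S) * (1 - 2 * U δ x t / t)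
        = U δ x t * (2 * VHat x t + 4 / 3 * S) := by
      rw [show (u * (2 * VHat x t) + 4 / 3 * u * S) * (1 - 2 * U δ x t / t)
        = u * (1 - 2 * U δ x t / t) * (2 * VHat x t + 4 / 3 * S) by ring, ← h3]
    rw [h5] at h4
    have h6 : S ^ 2 * (1 - 2 * U δ x t / t) = S ^ 2 - U δ x t * (2 * (S ^ 2 / t)) := by
      field_simp
    rw [h6] at h4
    linarith
  have hL1 : 1 ≤ Real.log (wealthStar x t m) := hU1.trans hmain.le
  rcases lt_or_ge |betaStar x t m| (9 / 20) with hb | hb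
  · linarith [log_wealthStar_le_of_small_bet hδ ht hx hm hne hacc hSV hL1 hb]
  · rcases log_wealthStar_le_of_large_bet hδ ht hx hm hne hacc hSV hL1 hb with h | h
    · linarith
    · rw [← hSdef] at h
      linarith

/-! ### From accepted values to the endpoints of the confidence interval. -/

theorem upper_le_mUp (ht : 1 ≤ t) : upper δ x t ≤ mUp δ x t := by
  obtain ⟨s, rfl⟩ : ∃ s, t = s + 1 := ⟨t - 1, by omega⟩
  exact min_le_left _ _

theorem mLow_le_lower (ht : 1 ≤ t) : mLow δ x t ≤ lower δ x t := by
  obtain ⟨s, rfl⟩ : ∃ s, t = s + 1 := ⟨t - 1, by omega⟩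
  exact le_max_left _ _

theorem half_width_le (hδ : δ ∈ Set.Ioo (0 : ℝ) 1) (ht : 1 ≤ t)
    (hx : ∀ i, x i ∈ Set.Icc (0 : ℝ) 1) {r : ℝ}
    (hr : ∀ m ∈ Set.Icc (0 : ℝ) 1, m ∈ accepted δ x t → |muHat x t - m| ≤ r) :
    upper δ x t - muHat x t ≤ r ∧ muHat x t - lower δ x t ≤ r := by
  have hμ := muHat_mem_accepted hδ ht hx
  have hμm := muHat_mem hx t
  constructor
  · have : mUp δ x t ≤ muHat x t + r := by
      refine csSup_le ⟨_, ⟨le_rfl, hμm.2⟩, hμ⟩ fun m hm => ?_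
      have := (abs_le.1 (hr m ⟨hμm.1.trans hm.1.1, hm.1.2⟩ hm.2)).1
      linarith
    linarith [upper_le_mUp (δ := δ) (x := x) ht]
  · have : muHat x t - r ≤ mLow δ x t := by
      refine le_csInf ⟨_, ⟨hμm.1, le_rfl⟩, hμ⟩ fun m hm => ?_
      have := (abs_le.1 (hr m ⟨hm.1.1, hm.1.2.trans hμm.2⟩ hm.2)).2
      linarith
    linarith [mLow_le_lower (δ := δ) (x := x) ht]

end Width

/-! ### Asymptotics -/

section Asymp

variable {x : ℕ → ℝ} {t : ℕ} {δ : ℝ}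

theorem VHat_le (hx : ∀ i, x i ∈ Set.Icc (0 : ℝ) 1) : VHat x t ≤ t := by
  unfold VHat V
  calc _ ≤ ∑ i ∈ Finset.range t, (1 : ℝ) := Finset.sum_le_sum fun i _ => by
        have := abs_sub_le_one hx (muHat_mem hx t) i
        rw [← sq_abs]
        exact pow_le_one₀ (abs_nonneg _) this
    _ = t := by simp

theorem c_le : c ≤ 18 := by
  have := Real.exp_one_lt_d9
  unfold c
  linarith

/-- The number whose iterated logarithms enter `U`. -/
def Uarg (x : ℕ → ℝ) (t : ℕ) : ℝ := c * (2 + √(VHat x t / 2))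

theorem Karg_le (hδ : 0 < δ) : 2.887 ≤ Real.log (Uarg x t) ∧
    1.06 ≤ Real.log (Real.log (Uarg x t)) ∧
    Karg δ x t ≤ 40 / (3 * δ) * (Real.log (Uarg x t) * Real.log (Real.log (Uarg x t)) ^ 2) := by
  have h1 := one_div_two_add_sqrt_mem (VHat x t / 2)
  have h2 := le_log_div h1.1 h1.2
  have h3 := le_log_log_div h1.1 h1.2
  have h4 : c / (1 / (2 + √(VHat x t / 2))) = Uarg x t := by
    rw [Uarg, div_div_eq_mul_div, div_one]
  have h5 := le_log_log_c
  unfold Karg h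
  rw [h4] at h2 h3 ⊢
  refine ⟨h2, h3, ?_⟩
  have h6 : 2 / Real.log (Real.log c) ≤ 2 := by
    rw [div_le_iff₀ (by linarith)]; linarith
  have : 0 ≤ Real.log (Uarg x t) := by linarith
  calc _ ≤ 20 / (3 * δ) * (2 * Real.log (Uarg x t) * Real.log (Real.log (Uarg x t)) ^ 2) := by
        gcongr
    _ = _ := by ring

theorem Uarg_pos : 0 < Uarg x t := by
  have := c_pos
  unfold Uarg
  positivity

theorem log_Uarg_le (hx : ∀ i, x i ∈ Set.Icc (0 : ℝ) 1) (ht : 16 ≤ t) :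
    Real.log (Uarg x t) ≤ 2 * Real.log t := by
  have ht' : (16 : ℝ) ≤ t := by exact_mod_cast ht
  have ht0 : (0 : ℝ) < t := by linarith
  have h1 : Uarg x t ≤ (t : ℝ) ^ 2 := by
    have h2 : √(VHat x t / 2) ≤ √t := Real.sqrt_le_sqrt (by
      linarith [VHat_le (t := t) hx, VHat_nonneg (x := x) (t := t)])
    have h3 : 4 ≤ √(t : ℝ) := Real.le_sqrt_of_sq_le (by linarith)
    have h4 := Real.sq_sqrt ht0.le
    have h5 : Uarg x t ≤ 18 * (2 + √t) := by
      unfold Uarg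
      have := c_le
      gcongr
    nlinarith
  calc Real.log (Uarg x t) ≤ Real.log ((t : ℝ) ^ 2) := Real.log_le_log Uarg_pos h1
    _ = _ := by rw [Real.log_pow]; norm_num

theorem log_ge_two_of_le (ht : 16 ≤ t) : 2 ≤ Real.log t := by
  have ht' : (16 : ℝ) ≤ t := by exact_mod_cast ht
  refine le_trans ?_ (Real.log_le_log (by norm_num) ht')
  rw [show (16 : ℝ) = 2 ^ 4 by norm_num, Real.log_pow]
  have := Real.log_two_gt_d9
  push_cast
  linarith

theorem one_le_log_cube_div (hδ : δ ∈ Set.Ioo (0 : ℝ) 1) (ht : 16 ≤ t) :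
    1 ≤ Real.log (Real.log t ^ 3 / δ) := by
  have h1 := log_ge_two_of_le ht
  have h2 : (2 : ℝ) ^ 3 ≤ Real.log t ^ 3 := by gcongr
  have h3 := Real.exp_one_lt_d9
  have hδ0 := hδ.1
  rw [Real.le_log_iff_exp_le (by positivity), le_div_iff₀ hδ0]
  nlinarith [hδ.2]

theorem U_le_log_cube (hδ : δ ∈ Set.Ioo (0 : ℝ) 1) (hx : ∀ i, x i ∈ Set.Icc (0 : ℝ) 1)
    (ht : 16 ≤ t) :
    U δ x t ≤ (2 * Real.log (320 / 3) + 2) * Real.log (Real.log t ^ 3 / δ) := by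
  have hδ0 := hδ.1
  obtain ⟨h1, h2, h3⟩ := Karg_le (x := x) (t := t) hδ0
  have h4 := log_Uarg_le hx ht
  have h5 := log_ge_two_of_le ht
  -- Crude on purpose: bounding the iterated logarithm by the logarithm yields the cube in `ln³ t`.
  have h6 : Real.log (Real.log (Uarg x t)) ≤ 2 * Real.log t :=
    (Real.log_le_self (by linarith)).trans h4
  have h7 : Karg δ x t ≤ 320 / 3 * (Real.log t ^ 3 / δ) := by
    refine h3.trans ?_
    calc _ ≤ 40 / (3 * δ) * (2 * Real.log t * (2 * Real.log t) ^ 2) := by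
          have : 0 ≤ Real.log (Real.log (Uarg x t)) := by linarith
          gcongr
      _ = _ := by field_simp; ring
  have h8 := Real.log_le_log (Karg_pos hδ) h7
  have hpos : 0 < Real.log t ^ 3 / δ := by positivity
  rw [Real.log_mul (by norm_num) hpos.ne'] at h8
  have h9 := one_le_log_cube_div hδ ht
  have h10 : 0 ≤ Real.log (320 / 3 : ℝ) := Real.log_nonneg (by norm_num)
  obtain ⟨-, h11, -⟩ := U_spec (x := x) (t := t) hδ
  nlinarith

/-- `U` exceeds `ln (ln V_t / δ)` at most by terms of lower order than `ln ln t`. -/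
theorem U_le_log_log (hδ : δ ∈ Set.Ioo (0 : ℝ) 1) (hx : ∀ i, x i ∈ Set.Icc (0 : ℝ) 1)
    (ht : 16 ≤ t) (hs : 1 ≤ Real.log (Real.log t)) (hV : Real.exp 1 < VHat x t) :
    U δ x t ≤ Real.log (Real.log (VHat x t) / δ) + Real.log (800 / 3)
      + 2 * Real.log (Real.log (Real.log t)) + 1 / 2 * Real.log (U δ x t) := by
  have hδ0 := hδ.1
  obtain ⟨h1, h2, h3⟩ := Karg_le (x := x) (t := t) hδ0
  have h5 := log_ge_two_of_le ht
  have hV0 : 0 < VHat x t := (Real.exp_pos 1).trans hV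
  have hlV : 1 < Real.log (VHat x t) := (Real.lt_log_iff_exp_lt hV0).2 hV
  have hV1 : 1 ≤ VHat x t := by linarith [Real.exp_one_gt_d9]
  -- `Uarg ≤ 54 V ≤ e⁴ V`, and `4 < 4 ln V` because `V > e`.
  have h6 : Real.log (Uarg x t) ≤ 5 * Real.log (VHat x t) := by
    have h7 : Uarg x t ≤ Real.exp 4 * VHat x t := by
      have h8 : √(VHat x t / 2) ≤ VHat x t :=
        Real.sqrt_le_iff.2 ⟨hV0.le, by nlinarith⟩
      have h9 : Uarg x t ≤ 18 * (2 + VHat x t) := by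
        unfold Uarg
        have := c_le
        gcongr
      have h10 : (54 : ℝ) ≤ Real.exp 4 := by
        have he := Real.exp_one_gt_d9
        have : Real.exp 4 = Real.exp 1 ^ 4 := by rw [← Real.exp_nat_mul]; norm_num
        rw [this]
        have : (2.718 : ℝ) ^ 4 ≤ Real.exp 1 ^ 4 := by gcongr; linarith
        norm_num at this ⊢
        linarith
      nlinarith
    have h8 := Real.log_le_log Uarg_pos h7
    rw [Real.log_mul (Real.exp_ne_zero _) hV0.ne', Real.log_exp] at h8
    linarith
  have h7 : Real.log (Real.log (Uarg x t)) ≤ 2 * Real.log (Real.log t) := by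
    have h8 := Real.log_le_log (by linarith) (log_Uarg_le hx ht)
    rw [Real.log_mul (by norm_num) (by linarith)] at h8
    linarith [Real.log_two_lt_d9]
  have h8 : Karg δ x t ≤ Real.log (VHat x t) / δ * (800 / 3 * Real.log (Real.log t) ^ 2) := by
    refine h3.trans ?_
    calc _ ≤ 40 / (3 * δ) * (5 * Real.log (VHat x t) * (2 * Real.log (Real.log t)) ^ 2) := by
          have : 0 ≤ Real.log (Real.log (Uarg x t)) := by linarith
          have : 0 ≤ Real.log (VHat x t) := by linarith
          gcongr
      _ = _ := by field_simp; ring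
  have h9 := Real.log_le_log (Karg_pos hδ) h8
  have hs0 : 0 < Real.log (Real.log t) := by linarith
  have hp : 0 < Real.log (VHat x t) / δ := div_pos (by linarith) hδ0
  rw [Real.log_mul hp.ne' (by positivity), Real.log_mul (by norm_num) (by positivity),
    Real.log_pow] at h9
  push_cast at h9
  obtain ⟨-, -, h11⟩ := U_spec (x := x) (t := t) hδ
  linarith

theorem lilWidth_nonneg : 0 ≤ lilWidth δ x t := by
  unfold lilWidth
  split_ifs <;> positivity

theorem sqrt_add_le_add_sqrt {y z : ℝ} (hy : 0 ≤ y) (hz : 0 ≤ z) : √(y + z) ≤ √y + √z := by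
  rw [Real.sqrt_le_iff]
  refine ⟨by positivity, ?_⟩
  nlinarith [Real.sq_sqrt hy, Real.sq_sqrt hz, mul_nonneg (Real.sqrt_nonneg y) (Real.sqrt_nonneg z)]

/-- The quantity under the root exceeds `2 V ln (ln V / δ)` by at most `2 V D` with `D = O(ln ln ln
t)`; subadditivity of the root and `V ≤ t` make this an error `√(2D/t)`. All other contributions are
`O(ln ln t / t)`. -/
theorem widthBound_le_lilWidth_add (hδ : δ ∈ Set.Ioo (0 : ℝ) 1)
    (hx : ∀ i, x i ∈ Set.Icc (0 : ℝ) 1) (ht : 16 ≤ t) (hs : 1 ≤ Real.log (Real.log t)) {C : ℝ}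
    (hC : 1 ≤ C) (hU : U δ x t ≤ C * Real.log (Real.log t))
    (hCt : 4 * (C * Real.log (Real.log t)) ≤ t) (hst : Real.log (Real.log t) ^ 2 ≤ t) :
    widthBound δ x t ≤ lilWidth δ x t
      + (√(2 * (Real.log (800 / 3) + C + 4 * C ^ 2 + 3 * Real.log (Real.log (Real.log t))) / t)
        + (√(4 * C * Real.exp 1) + 8 / 3 * C + 24 * Real.log (7 / (6 * δ)))
          * (Real.log (Real.log t) / t)) := by
  obtain ⟨hU1, -, -⟩ := U_spec (x := x) (t := t) hδ
  obtain ⟨s, hsdef⟩ : ∃ s, s = Real.log (Real.log t) := ⟨_, rfl⟩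
  have hV := VHat_nonneg (x := x) (t := t)
  have hVt := VHat_le (t := t) hx
  have ht0 : (0 : ℝ) < t := by
    have : 0 < t := by omega
    exact_mod_cast this
  have hlog : 0 < Real.log (7 / (6 * δ)) := by
    refine Real.log_pos ?_
    rw [lt_div_iff₀ (by linarith [hδ.1])]
    linarith [hδ.2]
  have hll := U_le_log_log hδ hx ht hs
  rw [← hsdef] at hs hU hCt hst hll ⊢
  have hs0 : 0 < s := by linarith
  have hls : 0 ≤ Real.log s := Real.log_nonneg hs
  obtain ⟨Q, hQ⟩ : ∃ Q, Q = U δ x t := ⟨_, rfl⟩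
  obtain ⟨u, hu⟩ : ∃ u, u = Q / (1 - 2 * Q / t) := ⟨_, rfl⟩
  rw [← hQ] at hU1 hU hll
  have hQt : 2 * Q / t ≤ 1 / 2 := by
    rw [div_le_div_iff₀ ht0 (by norm_num)]; linarith
  have hk : 0 < 1 - 2 * Q / t := by linarith
  have hQt0 : 0 ≤ 2 * Q / t := by positivity
  have hu1 : 1 ≤ u := by rw [hu, le_div_iff₀ hk]; linarith
  have hu2 : u ≤ 2 * (C * s) := by
    rw [hu, div_le_iff₀ hk]; nlinarith
  -- Uses `1 / (1 - r) ≤ 1 + 2r` for `r = 2Q/t ≤ 1/2`; the excess `4 Q²/t` is bounded because `Q ≤ C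
  -- s` and `s² ≤ t`.
  have hu3 : u ≤ Q + 4 * C ^ 2 := by
    have h1 : u ≤ Q + Q * (4 * Q / t) := by
      rw [hu, div_le_iff₀ hk]
      have : 4 * Q / t = 2 * (2 * Q / t) := by ring
      rw [this]
      nlinarith [mul_nonneg hQt0 (show (0 : ℝ) ≤ 1 / 2 - 2 * Q / t by linarith)]
    have h2 : Q * (4 * Q / t) ≤ 4 * C ^ 2 := by
      rw [mul_div_assoc', div_le_iff₀ ht0]
      have h3 : Q ^ 2 ≤ (C * s) ^ 2 := by gcongr
      nlinarith [sq_nonneg C]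
    linarith
  have hlog3 : 24 / t * Real.log (7 / (6 * δ)) ≤ 24 * Real.log (7 / (6 * δ)) * (s / t) := by
    rw [div_mul_eq_mul_div, mul_div_assoc', div_le_div_iff_of_pos_right ht0]
    exact le_mul_of_one_le_right (by positivity) hs
  have hmid : 4 / 3 * Q / (t - 2 * Q) ≤ 8 / 3 * C * (s / t) := by
    have h1 : t / 2 ≤ t - 2 * Q := by linarith
    calc 4 / 3 * Q / (t - 2 * Q) ≤ 4 / 3 * (C * s) / (t / 2) := by gcongr
      _ = _ := by field_simp; ring
  have hsqrt : 1 / t * √(u * (2 * VHat x t)) ≤ lilWidth δ x t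
      + √(2 * (Real.log (800 / 3) + C + 4 * C ^ 2 + 3 * Real.log s) / t)
      + √(4 * C * Real.exp 1) * (s / t) := by
    have hA : 0 ≤ √(2 * (Real.log (800 / 3) + C + 4 * C ^ 2 + 3 * Real.log s) / t) :=
      Real.sqrt_nonneg _
    have hB : 0 ≤ √(4 * C * Real.exp 1) * (s / t) := by positivity
    unfold lilWidth
    split_ifs with hVe
    · have h1 := hll hVe
      have h2 : 1 / 2 * Real.log Q ≤ C + Real.log s := by
        have h3 := Real.log_le_log (by linarith) hU
        rw [Real.log_mul (by linarith) hs0.ne'] at h3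
        have := Real.log_le_self (show 0 ≤ C by linarith)
        linarith
      have hV0 : 0 < VHat x t := (Real.exp_pos 1).trans hVe
      have hlV : 1 < Real.log (VHat x t) := (Real.lt_log_iff_exp_lt hV0).2 hVe
      have hΛ : 0 ≤ Real.log (Real.log (VHat x t) / δ) := by
        refine Real.log_nonneg ?_
        rw [le_div_iff₀ hδ.1]
        linarith [hδ.2]
      have h800 : 0 ≤ Real.log (800 / 3 : ℝ) := Real.log_nonneg (by norm_num)
      obtain ⟨D, hD⟩ : ∃ D, D = Real.log (800 / 3) + C + 4 * C ^ 2 + 3 * Real.log s := ⟨_, rfl⟩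
      have hD0 : 0 ≤ D := by rw [hD]; positivity
      have huD : u ≤ Real.log (Real.log (VHat x t) / δ) + D := by rw [hD]; linarith
      rw [← hD]
      have h4 : √(u * (2 * VHat x t)) ≤ √(2 * VHat x t * Real.log (Real.log (VHat x t) / δ))
          + √(2 * D * t) := by
        refine le_trans (Real.sqrt_le_sqrt ?_) (sqrt_add_le_add_sqrt (by positivity) (by positivity))
        nlinarith
      have h5 : √(2 * D * t) / t = √(2 * D / t) := by
        rw [show 2 * D * (t : ℝ) = 2 * D / t * (t : ℝ) ^ 2 by field_simp,
          Real.sqrt_mul (by positivity), Real.sqrt_sq ht0.le]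
        field_simp
      calc 1 / t * √(u * (2 * VHat x t))
          ≤ 1 / t * (√(2 * VHat x t * Real.log (Real.log (VHat x t) / δ)) + √(2 * D * t)) := by
            gcongr
        _ = √(2 * VHat x t * Real.log (Real.log (VHat x t) / δ)) / t + √(2 * D / t) := by
            rw [← h5]; ring
        _ ≤ _ := by linarith
    · have h1 : √(u * (2 * VHat x t)) ≤ √(4 * C * Real.exp 1) * s := by
        have : √(4 * C * Real.exp 1) * s = √(4 * C * Real.exp 1 * s ^ 2) := by
          rw [Real.sqrt_mul (by positivity) (s ^ 2), Real.sqrt_sq hs0.le]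
        rw [this]
        refine Real.sqrt_le_sqrt ?_
        calc u * (2 * VHat x t) ≤ 2 * (C * s) * (2 * Real.exp 1) := by
              gcongr
              exact not_lt.1 hVe
          _ ≤ 4 * C * Real.exp 1 * s ^ 2 := by
              have : s ≤ s ^ 2 := by nlinarith
              have : 0 < C * Real.exp 1 := by positivity
              nlinarith
      calc 1 / t * √(u * (2 * VHat x t)) ≤ 1 / t * (√(4 * C * Real.exp 1) * s) := by gcongr
        _ = √(4 * C * Real.exp 1) * (s / t) := by ring
        _ ≤ _ := by linarith
  unfold widthBound
  rw [← hQ, ← hu, max_eq_left hu1]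
  linarith

theorem tendsto_log_log : Tendsto (fun t : ℕ => Real.log (Real.log t)) atTop atTop :=
  Real.tendsto_log_atTop.comp (Real.tendsto_log_atTop.comp tendsto_natCast_atTop_atTop)

theorem tendsto_log_log_sq_div :
    Tendsto (fun t : ℕ => Real.log (Real.log t) ^ 2 / t) atTop (nhds 0) := by
  have h1 : (fun t : ℕ => Real.log (t : ℝ) ^ 2) =o[atTop] fun t : ℕ => (t : ℝ) :=
    (Real.isLittleO_pow_log_id_atTop (n := 2)).comp_tendsto tendsto_natCast_atTop_atTop
  refine squeeze_zero' (Eventually.of_forall fun t => by positivity) ?_ h1.tendsto_div_nhds_zero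
  filter_upwards [eventually_ge_atTop 16, tendsto_log_log.eventually_ge_atTop 0] with t ht hs
  have := log_ge_two_of_le ht
  have : Real.log (Real.log t) ≤ Real.log t := Real.log_le_self (by linarith)
  gcongr

theorem tendsto_log_log_div :
    Tendsto (fun t : ℕ => Real.log (Real.log t) / t) atTop (nhds 0) := by
  refine squeeze_zero' ?_ ?_ tendsto_log_log_sq_div
  · filter_upwards [tendsto_log_log.eventually_ge_atTop 0] with t hs
    positivity
  · filter_upwards [tendsto_log_log.eventually_ge_atTop 1] with t hs
    gcongr
    nlinarith

theorem isLittleO_lil_remainder (A B : ℝ) :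
    (fun t : ℕ => √(2 * (A + 3 * Real.log (Real.log (Real.log t))) / t)
      + B * (Real.log (Real.log t) / t)) =o[atTop]
      fun t : ℕ => √(Real.log (Real.log t) / t) := by
  have hpos : ∀ᶠ t : ℕ in atTop, 0 < Real.log (Real.log t) / t := by
    filter_upwards [tendsto_log_log.eventually_ge_atTop 1, eventually_ge_atTop 1] with t hs ht
    have : (0 : ℝ) < t := by exact_mod_cast ht
    positivity
  refine IsLittleO.add ?_ (IsLittleO.const_mul_left ?_ B)
  · refine IsLittleO.sqrt (isLittleO_of_tendsto' (hpos.mono fun t ht h0 => absurd h0 ht.ne') ?_)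
      (hpos.mono fun t ht => ht.le)
    have h1 : Tendsto (fun s : ℝ => 2 * A * s⁻¹ + 6 * (Real.log s / s)) atTop (nhds 0) := by
      have h2 := (tendsto_inv_atTop_zero (𝕜 := ℝ)).const_mul (2 * A)
      have h3 := (Real.isLittleO_log_id_atTop.tendsto_div_nhds_zero).const_mul 6
      simpa using h2.add h3
    refine (h1.comp tendsto_log_log).congr' ?_
    filter_upwards [tendsto_log_log.eventually_ge_atTop 1, eventually_ge_atTop 1] with t hs ht
    have : (0 : ℝ) < t := by exact_mod_cast ht
    have : 0 < Real.log (Real.log t) := by linarith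
    simp only [Function.comp_apply]
    field_simp
    ring
  · refine isLittleO_of_tendsto' ?_ ?_
    · filter_upwards [hpos] with t ht h0
      exact absurd h0 (Real.sqrt_pos.2 ht).ne'
    · have := (Real.continuous_sqrt.tendsto 0).comp tendsto_log_log_div
      rw [Real.sqrt_zero] at this
      refine this.congr' ?_
      filter_upwards [hpos] with t ht
      exact Real.div_sqrt.symm

theorem exists_lil_remainder (hδ : δ ∈ Set.Ioo (0 : ℝ) 1) :
    ∃ ε : ℕ → ℝ, ε =o[atTop] (fun t : ℕ => √(Real.log (Real.log t) / t)) ∧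
      ∀ x : ℕ → ℝ, (∀ i, x i ∈ Set.Icc (0 : ℝ) 1) → ∀ t : ℕ, 1 ≤ t →
        upper δ x t - muHat x t ≤ lilWidth δ x t + ε t ∧
        muHat x t - lower δ x t ≤ lilWidth δ x t + ε t := by
  -- The factor 4 absorbs `3 ln ln t + ln (1/δ)` once `ln ln t ≥ ln (1/δ)`; only this threshold
  -- depends on `δ`, and nothing depends on the sequence.
  obtain ⟨C, hC⟩ : ∃ C, C = (2 * Real.log (320 / 3) + 2) * 4 := ⟨_, rfl⟩
  have hlog : 0 ≤ Real.log (320 / 3 : ℝ) := Real.log_nonneg (by norm_num)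
  have hC1 : 1 ≤ C := by rw [hC]; linarith
  have hCt : ∀ᶠ t : ℕ in atTop, 4 * (C * Real.log (Real.log t)) ≤ t := by
    filter_upwards [(tendsto_log_log_div.const_mul (4 * C)).eventually_le_const
      (show 4 * C * 0 < 1 by norm_num), eventually_ge_atTop 1] with t h ht
    have : (0 : ℝ) < t := by exact_mod_cast ht
    rw [mul_div_assoc', div_le_one this] at h
    linarith
  have hst : ∀ᶠ t : ℕ in atTop, Real.log (Real.log t) ^ 2 ≤ t := by
    filter_upwards [tendsto_log_log_sq_div.eventually_le_const one_pos, eventually_ge_atTop 1]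
      with t h ht
    have : (0 : ℝ) < t := by exact_mod_cast ht
    rwa [div_le_one this] at h
  obtain ⟨T, hT⟩ := eventually_atTop.1 ((hCt.and hst).and
    ((tendsto_log_log.eventually_ge_atTop 1).and
      (tendsto_log_log.eventually_ge_atTop (Real.log (1 / δ)))))
  obtain ⟨E, hE⟩ : ∃ E : ℕ → ℝ, E = fun t : ℕ =>
      √(2 * (Real.log (800 / 3) + C + 4 * C ^ 2 + 3 * Real.log (Real.log (Real.log t))) / t)
        + (√(4 * C * Real.exp 1) + 8 / 3 * C + 24 * Real.log (7 / (6 * δ)))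
          * (Real.log (Real.log t) / t) := ⟨_, rfl⟩
  -- Before the asymptotic regime the remainder `1` suffices, since all points lie in `[0, 1]`;
  -- finitely many values do not affect the little-o.
  refine ⟨fun t => if max T 16 ≤ t then E t else 1, ?_, fun x hx t ht => ?_⟩
  · refine (isLittleO_lil_remainder (Real.log (800 / 3) + C + 4 * C ^ 2)
      (√(4 * C * Real.exp 1) + 8 / 3 * C + 24 * Real.log (7 / (6 * δ)))).congr' ?_ EventuallyEq.rfl
    filter_upwards [eventually_ge_atTop (max T 16)] with t ht
    rw [if_pos ht, hE]
  · refine half_width_le hδ ht hx fun m hm hacc => ?_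
    simp only
    split_ifs with hTt
    · have ht16 : 16 ≤ t := (le_max_right _ _).trans hTt
      obtain ⟨⟨h1, h2⟩, h3, h4⟩ := hT t ((le_max_left _ _).trans hTt)
      have hU : U δ x t ≤ C * Real.log (Real.log t) := by
        refine (U_le_log_cube hδ hx ht16).trans ?_
        have hl := log_ge_two_of_le ht16
        have h5 : Real.log (Real.log t ^ 3 / δ) ≤ 4 * Real.log (Real.log t) := by
          rw [Real.log_div (by positivity) hδ.1.ne', Real.log_pow]
          rw [one_div, Real.log_inv] at h4
          push_cast
          linarith
        rw [hC, mul_assoc]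
        gcongr
      obtain ⟨hU1, -, -⟩ := U_spec (x := x) (t := t) hδ
      refine (width_of_accepted hδ ht hx hm (by linarith) hacc).trans ?_
      rw [hE]
      exact widthBound_le_lilWidth_add hδ hx ht16 h3 hC1 hU h1 h2
    · have := muHat_mem hx t
      have := lilWidth_nonneg (δ := δ) (x := x) (t := t)
      rw [abs_le]
      constructor <;> linarith [hm.1, hm.2, (muHat_mem hx t).1, (muHat_mem hx t).2]

end Asymp

end PreciseR70

end

/-! ### Assembly of the five claims. -/

theorem theorem7 :
    -- regret of the mixture strategy, for every sequence of outcomes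
    (∀ x : ℕ → ℝ, (∀ i, x i ∈ Set.Icc (0 : ℝ) 1) → ∀ t : ℕ, 1 ≤ t → ∀ m ∈ Set.Icc (0 : ℝ) 1,
      (PreciseR70.regret x t m : EReal) ≤ ENNReal.log (PreciseR70.R x t m)) ∧
    -- time-uniform coverage with probability at least `1 - δ`
    (∀ δ ∈ Set.Ioo (0 : ℝ) 1, ∀ (Ω : Type*) [MeasurableSpace Ω] (P : Measure Ω)
      [IsProbabilityMeasure P] (X : ℕ → Ω → ℝ) (μ : ℝ),
      (∀ i, Measurable (X i)) →
      (∀ i, ∀ᵐ ω ∂P, X i ω ∈ Set.Icc (0 : ℝ) 1) →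
      (∀ i, P[X i | ⨆ j < i, MeasurableSpace.comap (X j) inferInstance] =ᵐ[P] fun _ => μ) →
      P {ω | ¬ ∀ t : ℕ, 1 ≤ t → μ ∈ Set.Icc (PreciseR70.lower δ (fun i => X i ω) t)
          (PreciseR70.upper δ (fun i => X i ω) t)} ≤ ENNReal.ofReal δ) ∧
    -- explicit half-width bound
    (∀ δ ∈ Set.Ioo (0 : ℝ) 1, ∀ x : ℕ → ℝ, (∀ i, x i ∈ Set.Icc (0 : ℝ) 1) → ∀ t : ℕ, 1 ≤ t →
      2 * PreciseR70.U δ x t < t →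
      PreciseR70.upper δ x t - PreciseR70.muHat x t ≤ PreciseR70.widthBound δ x t ∧
      PreciseR70.muHat x t - PreciseR70.lower δ x t ≤ PreciseR70.widthBound δ x t) ∧
    -- `U_t = O(ln (ln³ t / δ))`, uniformly in `δ` and in the sequence
    (∃ K : ℝ, ∃ t₀ : ℕ, ∀ δ ∈ Set.Ioo (0 : ℝ) 1, ∀ x : ℕ → ℝ, (∀ i, x i ∈ Set.Icc (0 : ℝ) 1) →
      ∀ t : ℕ, t₀ ≤ t → |PreciseR70.U δ x t| ≤ K * Real.log (Real.log t ^ 3 / δ)) ∧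
    -- law of the iterated logarithm, uniformly in the sequence
    (∀ δ ∈ Set.Ioo (0 : ℝ) 1, ∃ ε : ℕ → ℝ,
      ε =o[atTop] (fun t : ℕ => √(Real.log (Real.log t) / t)) ∧
      ∀ x : ℕ → ℝ, (∀ i, x i ∈ Set.Icc (0 : ℝ) 1) → ∀ t : ℕ, 1 ≤ t →
        PreciseR70.upper δ x t - PreciseR70.muHat x t ≤ PreciseR70.lilWidth δ x t + ε t ∧
        PreciseR70.muHat x t - PreciseR70.lower δ x t ≤ PreciseR70.lilWidth δ x t + ε t) := by
  refine ⟨fun x hx t ht m hm => PreciseR70.regret_le_log_R ht hx hm,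
    fun δ hδ Ω _ P _ X μ hX hX01 hcond => PreciseR70.coverage hδ P X μ hX hX01 hcond,
    fun δ hδ x hx t ht hU => PreciseR70.half_width_le hδ ht hx fun m hm hacc =>
      PreciseR70.width_of_accepted hδ ht hx hm hU hacc,
    ⟨2 * Real.log (320 / 3) + 2, 16, fun δ hδ x hx t ht => ?_⟩,
    fun δ hδ => PreciseR70.exists_lil_remainder hδ⟩
  obtain ⟨h1, -, -⟩ := PreciseR70.U_spec (x := x) (t := t) hδ
  rw [abs_of_nonneg (by linarith)]
  exact PreciseR70.U_le_log_cube hδ hx ht
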